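/- **Synchronous incremental voting on $K_n$.** Each vertex of the complete graph $K_n$ holds an integer opinion. In each synchronous step every vertex $v$, independently of the other vertices and of the past, observes a uniformly random vertex $w$, and all vertices update simultaneously: if $X_v<X_w$ then $X_v$ becomes $X_v+1$, if $X_v>X_w$ then $X_v$ becomes $X_v-1$, and if $X_v=X_w$ it is unchanged, where $X$ are the opinions before the step. Here $w$ is uniform on the other $n-1$ vertices, or, in an alternative convention, uniform on all $n$ vertices; the result holds for each of the two conventions. Opinion $j$ wins if at some time all vertices hold opinion $j$. For each $n$ let the initial opinions be arbitrary elements of $\{1,\dots,k\}$, where $k=k(n)=o(n/(\log n)^2)$, and let $c=c(n)$ be their average. All asymptotics are for $n\to\infty$. There is an absolute constant $C>0$ such that the following hold. (i) If $i=i(n)$ are integers with $i<c<i+1$ for all large $n$, then $$\mathbb P(i\text{ wins})=i+1-c+o(1),\qquad \mathbb P(i+1\text{ wins})=c-i+o(1).$$ In particular $\mathbb P(i\text{ wins})\sim i+1-c$ if $i+1-c$ is bounded away from $0$, and $\mathbb P(i+1\text{ wins})\sim c-i$ if $c-i$ is bounded away from $0$. If $i=i(n)$ are integers with $c=i+o(1)$,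 then $\mathbb P(i\text{ wins})\to 1$. (ii) With probability $1-o(1)$, after at most $Ck\log n$ steps all opinions lie in a set of three consecutive integers; and the expected number of steps until all vertices hold the same opinion is at most $Cn$ for all sufficiently large $n$. -/

import Mathlib

open Filter Asymptotics Topology MeasureTheory
open scoped ENNReal

namespace IncrementalVoting

/-- The two usual conventions for "a uniformly random neighbour" of a vertex:
* `others`: the vertex samples one of its neighbours in the graph
  (on the complete graph: one of the other `n - 1` vertices);
* `withSelf`: the vertex samples from its closed neighbourhood
  (on the complete graph: one of all `n` vertices, itself included). -/
inductive Sampling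
  | others
  | withSelf

section Law

variable {V : Type*} [Fintype V] [DecidableEq V]

/-- The vertices which `v` may sample. An isolated vertex, which has no neighbour to observe, only
sees itself (this keeps its opinion unchanged). -/
def candidates (G : SimpleGraph V) [DecidableRel G.Adj] : Sampling → V → Finset V
  | .others, v => if (G.neighborFinset v).Nonempty then G.neighborFinset v else {v}
  | .withSelf, v => insert v (G.neighborFinset v)

theorem candidates_nonempty (G : SimpleGraph V) [DecidableRel G.Adj] (s : Sampling) (v : V) :
    (candidates G s v).Nonempty := by
  cases s
  · simp only [candidates]
    split_ifs with h
    · exact h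
    · exact Finset.singleton_nonempty v
  · exact Finset.insert_nonempty _ _

/-- The law of the vertex sampled by `v` in one step: uniform on the candidates. -/
noncomputable def pickLaw (G : SimpleGraph V) [DecidableRel G.Adj] (s : Sampling) (v : V) : PMF V :=
  PMF.uniformOfFinset (candidates G s v) (candidates_nonempty G s v)

/-- The law of all the choices `ω t v` (the vertex observed by `v` in the step from time `t` to
time `t + 1`): they are independent over all `t` and `v`, and `ω t v` has law `pickLaw G s v`. -/
noncomputable def choiceMeasure [MeasurableSpace V] (G : SimpleGraph V) [DecidableRel G.Adj]
    (s : Sampling) : Measure (ℕ → V → V) :=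
  Measure.infinitePi fun _ : ℕ => Measure.pi fun v : V => (pickLaw G s v).toMeasure

end Law

/-- The new opinion of a vertex with opinion `x` that observes opinion `y`. -/
def update (x y : ℤ) : ℤ :=
  if x < y then x + 1 else if y < x then x - 1 else x

section Trajectory

variable {V : Type*}

/-- The opinions at time `t` in the synchronous process started from `x₀`, when `ω t v` is the
vertex observed by `v` in the step from time `t` to time `t + 1`. -/
def opinions (x₀ : V → ℤ) (ω : ℕ → V → V) : ℕ → V → ℤ
  | 0 => x₀
  | t + 1 => fun v => update (opinions x₀ ω t v) (opinions x₀ ω t (ω t v))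

/-- The event that opinion `i` wins: at some time all vertices hold opinion `i`. -/
def wins (x₀ : V → ℤ) (i : ℤ) : Set (ℕ → V → V) :=
  {ω | ∃ t, ∀ v, opinions x₀ ω t v = i}

/-- The event that at some time `t ≤ T` all opinions lie among three consecutive integers. -/
def threeLeftBy (x₀ : V → ℤ) (T : ℝ) : Set (ℕ → V → V) :=
  {ω | ∃ t : ℕ, (t : ℝ) ≤ T ∧ ∃ j : ℤ, ∀ v, opinions x₀ ω t v ∈ Set.Icc j (j + 2)}

/-- The first time at which all vertices hold the same opinion (`∞` if there is none). -/
noncomputable def consensusTime (x₀ : V → ℤ) (ω : ℕ → V → V) : ℝ≥0∞ :=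
  ⨅ (t : ℕ) (_ : ∃ i : ℤ, ∀ v, opinions x₀ ω t v = i), (t : ℝ≥0∞)

/-- The average of the opinions. -/
noncomputable def average [Fintype V] (x : V → ℤ) : ℝ :=
  (∑ v, (x v : ℝ)) / Fintype.card V

end Trajectory

/-- The law of the choices on the complete graph with vertex set `Fin n`. -/
noncomputable def completeLaw (s : Sampling) (n : ℕ) : Measure (ℕ → Fin n → Fin n) :=
  choiceMeasure (⊤ : SimpleGraph (Fin n)) s

/-- The probability that opinion `i` wins in the synchronous process on the complete graph. -/
noncomputable def winProb (s : Sampling) {n : ℕ} (x₀ : Fin n → ℤ) (i : ℤ) : ℝ :=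
  (completeLaw s n).real (wins x₀ i)

end IncrementalVoting

/-! The average opinion is a martingale, because the changes of two vertices that observe each other
cancel. One round changes the sum of the opinions with variance at most n, so over t steps the
average moves by at most `√(t / n)` in mean, which is o(1) for t = O(k log n) = o(n). It remains to
see that the opinions gather around the average within that time and that consensus then takes O(n)
steps.

Reduction to three opinions: let A and B count the lowest and the highest opinion. While the spread
is at least 3, E A' = A·u and E B' = B·w with u + w ≤ 1, and A', B' are negatively correlated, so
the mean of AB falls by a factor 4 per step. The weight (4n²)^spread pays for the jump of AB when an
extreme opinion dies out (`nextMean_extremePotential_le`); hence a spread of 3 or more survives t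
steps with probability at most (4n²)^k / 2^t.

Three opinions: Y = √(AB) loses Y²/m per step on average, with m = `n - deficit s`. So its mean
after t steps is at most m/(t + 1) (`mean_outerMean_le`), and a concave function of Y bounds the
expected time in this phase by 2n. Two opinions: the process is the voter model, and the strict
concavity of the square root makes √A + √B fall on average by at least 1/(32√n) per step, which
bounds this phase by 64n.

Winner: `below i` is a supermartingale by convexity. At time 2T with T = O(k log n) its mean is at
most max(i - c, 0) + o(1), and so it stays (`mean_below_le`); `above i` is its mirror image. For i <
c < i + 1 the means of `below i` and `above (i + 1)` are therefore o(1), so the mean of `clipped i`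
is c - i + o(1) at late times, while at consensus on i or i + 1 `clipped i` is the indicator of i +
1. -/

namespace IncrementalVoting

/-! ### The one-step map and the law of one round -/

open ProbabilityTheory

/-- The opinions after one step in which `v` observes `σ v`. -/
def step {V : Type*} (x : V → ℤ) (σ : V → V) : V → ℤ := fun v => update (x v) (x (σ v))

theorem opinions_succ {V : Type*} (x : V → ℤ) (ω : ℕ → V → V) (t : ℕ) :
    opinions x ω (t + 1) = step (opinions x ω t) (ω t) := rfl

theorem opinions_congr {V : Type*} (x : V → ℤ) {ω ω' : ℕ → V → V} (t : ℕ)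
    (h : ∀ u < t, ω u = ω' u) : opinions x ω t = opinions x ω' t := by
  induction t with
  | zero => rfl
  | succ t ih =>
    rw [opinions_succ, opinions_succ, ih fun u hu => h u (by omega), h t (by omega)]

theorem opinions_mem {V : Type*} {D : Set (V → ℤ)} (hD : ∀ x ∈ D, ∀ σ, step x σ ∈ D)
    {x : V → ℤ} (hx : x ∈ D) (ω : ℕ → V → V) (t : ℕ) : opinions x ω t ∈ D := by
  induction t with
  | zero => exact hx
  | succ t ih => exact hD _ ih _

/-- The law of all the choices made in one step on the complete graph. -/
noncomputable def stepLaw (s : Sampling) (n : ℕ) : Measure (Fin n → Fin n) :=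
  Measure.pi fun v => (pickLaw (⊤ : SimpleGraph (Fin n)) s v).toMeasure

instance (s : Sampling) (n : ℕ) : IsProbabilityMeasure (stepLaw s n) := by
  unfold stepLaw; infer_instance

theorem completeLaw_eq (s : Sampling) (n : ℕ) :
    completeLaw s n = Measure.infinitePi fun _ : ℕ => stepLaw s n := rfl

instance (s : Sampling) (n : ℕ) : IsProbabilityMeasure (completeLaw s n) := by
  rw [completeLaw_eq]; infer_instance

/-- The number of vertices that a vertex of the complete graph cannot sample. -/
def deficit : Sampling → ℝ
  | .others => 1
  | .withSelf => 0

theorem deficit_nonneg (s : Sampling) : 0 ≤ deficit s := by cases s <;> simp [deficit]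

theorem deficit_le_one (s : Sampling) : deficit s ≤ 1 := by cases s <;> simp [deficit]

/-! ### Markov property and calculus of one-step means -/

section OneStep

variable {n : ℕ}

theorem integral_pickLaw (s : Sampling) (hn : 2 ≤ n) (v : Fin n) (g : Fin n → ℝ) :
    ∫ w, g w ∂(pickLaw (⊤ : SimpleGraph (Fin n)) s v).toMeasure
      = (∑ w, g w - deficit s * g v) / (n - deficit s) := by
  rw [PMF.integral_eq_sum]
  have key : ∀ S : Finset (Fin n), candidates (⊤ : SimpleGraph (Fin n)) s v = S →
      ∑ a, ((pickLaw (⊤ : SimpleGraph (Fin n)) s v) a).toReal • g a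
        = (∑ w ∈ S, g w) / (S.card : ℝ) := by
    intro S hS
    rw [Finset.sum_div, ← Finset.sum_subset (Finset.subset_univ S)]
    · refine Finset.sum_congr rfl fun w hw => ?_
      rw [pickLaw, PMF.uniformOfFinset_apply_of_mem _ (hS ▸ hw)]
      simp [hS, div_eq_inv_mul]
    · intro w _ hw
      rw [pickLaw, PMF.uniformOfFinset_apply_of_notMem _ (hS ▸ hw)]
      simp
  cases s
  · rw [key (Finset.univ.erase v)]
    · rw [Finset.sum_erase_eq_sub (Finset.mem_univ v), Finset.card_erase_of_mem (Finset.mem_univ v)]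
      simp [deficit, Nat.cast_sub (by omega : 1 ≤ n)]
    · have h : (⊤ : SimpleGraph (Fin n)).neighborFinset v = Finset.univ.erase v := by
        ext w; simp [eq_comm]
      have h' : (Finset.univ.erase v).Nonempty := by
        rw [← Finset.card_pos, Finset.card_erase_of_mem (Finset.mem_univ v)]
        simp; omega
      simp only [candidates, h, h', if_true]
  · rw [key Finset.univ]
    · simp [deficit]
    · ext w; simp [candidates]

theorem integral_choice (s : Sampling) (hn : 2 ≤ n) (v : Fin n) (g : Fin n → ℝ) :
    ∫ σ, g (σ v) ∂stepLaw s n = (∑ w, g w - deficit s * g v) / (n - deficit s) := by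
  rw [← integral_pickLaw s hn v g]
  have h := measurePreserving_eval
    (fun v => (pickLaw (⊤ : SimpleGraph (Fin n)) s v).toMeasure) v
  rw [← h.map_eq, integral_map h.measurable.aemeasurable]
  · rfl
  · exact Measurable.of_discrete.aestronglyMeasurable

theorem iIndepFun_choice (s : Sampling) (g : Fin n → Fin n → ℝ) :
    iIndepFun (fun v (σ : Fin n → Fin n) => g v (σ v)) (stepLaw s n) :=
  iIndepFun_pi fun _ => Measurable.of_discrete.aemeasurable

theorem integrable_stepLaw (s : Sampling) (g : (Fin n → Fin n) → ℝ) :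
    Integrable g (stepLaw s n) := .of_finite

/-- The mean of `f` after one step. -/
noncomputable def nextMean (s : Sampling) (f : (Fin n → ℤ) → ℝ) (x : Fin n → ℤ) : ℝ :=
  ∫ σ, f (step x σ) ∂stepLaw s n

/-- The mean of `f` after `t` steps. -/
noncomputable def mean (s : Sampling) (t : ℕ) (f : (Fin n → ℤ) → ℝ) (x : Fin n → ℤ) : ℝ :=
  ∫ ω, f (opinions x ω t) ∂completeLaw s n

/-- The opinions at time `t` as a function of the first `t` rounds of choices. -/
def opinionsOfPrefix (x : Fin n → ℤ) (t : ℕ) (r : Finset.range t → Fin n → Fin n) : Fin n → ℤ :=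
  opinions x (fun u => if h : u ∈ Finset.range t then r ⟨u, h⟩ else id) t

theorem opinionsOfPrefix_restrict (x : Fin n → ℤ) (t : ℕ) (ω : ℕ → Fin n → Fin n) :
    opinionsOfPrefix x t (fun u => ω u) = opinions x ω t :=
  opinions_congr x t fun u hu => by simp [hu]

theorem measurable_opinions (x : Fin n → ℤ) (t : ℕ) :
    Measurable fun ω : ℕ → Fin n → Fin n => opinions x ω t := by
  simp_rw [← opinionsOfPrefix_restrict x t]
  exact (Measurable.of_discrete (f := opinionsOfPrefix x t)).comp (by fun_prop)

/-- The opinions at time t depend on finitely many choices from a finite set, so every function of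
them is bounded. -/
theorem integrable_opinions (s : Sampling) (t : ℕ) (f : (Fin n → ℤ) → ℝ) (x : Fin n → ℤ) :
    Integrable (fun ω => f (opinions x ω t)) (completeLaw s n) := by
  obtain ⟨C, hC⟩ := (Set.finite_range fun r => ‖f (opinionsOfPrefix x t r)‖).bddAbove
  refine Integrable.of_bound
    ((Measurable.of_discrete (f := f)).comp (measurable_opinions x t)).aestronglyMeasurable C
    (ae_of_all _ fun ω => ?_)
  have := hC (Set.mem_range_self (fun u : Finset.range t => ω u))
  simpa [opinionsOfPrefix_restrict] using this

theorem indepFun_opinions (s : Sampling) (x : Fin n → ℤ) (t : ℕ) :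
    IndepFun (fun ω => opinions x ω t) (fun ω => ω t) (completeLaw s n) := by
  have h : iIndepFun (fun (t : ℕ) (ω : ℕ → Fin n → Fin n) => ω t) (completeLaw s n) := by
    rw [completeLaw_eq]
    exact iIndepFun_infinitePi (X := fun _ ω => ω) (fun _ => measurable_id)
  have h' := h.indepFun_finset (Finset.range t) {t} (by simp) (fun i => measurable_pi_apply i)
  have := h'.comp (φ := opinionsOfPrefix x t) (ψ := fun r => r ⟨t, by simp⟩)
    Measurable.of_discrete Measurable.of_discrete
  convert this using 1
  · ext ω : 1
    exact (opinionsOfPrefix_restrict x t ω).symm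
  · rfl

/-- The Markov property: split according to the finitely many values of round t, which is
independent of the opinions at time t. -/
theorem mean_succ (s : Sampling) (t : ℕ) (f : (Fin n → ℤ) → ℝ) (x : Fin n → ℤ) :
    mean s (t + 1) f x = mean s t (nextMean s f) x := by
  have hlaw : ∀ σ : Fin n → Fin n, ∫ ω, (if ω t = σ then (1 : ℝ) else 0) ∂completeLaw s n
      = (stepLaw s n).real {σ} := by
    intro σ
    have h := measurePreserving_eval_infinitePi (fun _ : ℕ => stepLaw s n) t
    have h2 : completeLaw s n {ω | ω t = σ} = stepLaw s n {σ} :=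
      h.measure_preimage (MeasurableSet.singleton σ).nullMeasurableSet
    have h3 : MeasurableSet {ω : ℕ → Fin n → Fin n | ω t = σ} :=
      h.measurable (MeasurableSet.singleton σ)
    have : (fun ω : ℕ → Fin n → Fin n => if ω t = σ then (1 : ℝ) else 0)
        = {ω : ℕ → Fin n → Fin n | ω t = σ}.indicator 1 := by
      ext ω; by_cases hω : ω t = σ <;> simp [hω]
    rw [this, integral_indicator_one h3, measureReal_def, h2, measureReal_def]
  calc mean s (t + 1) f x
      = ∫ ω, ∑ σ, (if ω t = σ then (1 : ℝ) else 0) * f (step (opinions x ω t) σ)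
          ∂completeLaw s n := by
        refine integral_congr_ae (ae_of_all _ fun ω => ?_)
        simp [opinions_succ]
    _ = ∑ σ, ∫ ω, (if ω t = σ then (1 : ℝ) else 0) * f (step (opinions x ω t) σ)
          ∂completeLaw s n := by
        refine integral_finsetSum _ fun σ _ => ?_
        refine Integrable.bdd_mul (c := 1) (integrable_opinions s t (fun y => f (step y σ)) x) ?_ ?_
        · exact ((Measurable.of_discrete
            (f := fun τ : Fin n → Fin n => if τ = σ then (1 : ℝ) else 0)).comp
            (measurable_pi_apply t)).aestronglyMeasurable
        · refine ae_of_all _ fun ω => ?_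
          split_ifs <;> simp
    _ = ∑ σ, ∫ ω, (stepLaw s n).real {σ} * f (step (opinions x ω t) σ)
          ∂completeLaw s n := by
        refine Finset.sum_congr rfl fun σ _ => ?_
        have := ((indepFun_opinions s x t).symm.comp
          (φ := fun τ => if τ = σ then (1 : ℝ) else 0) (ψ := fun y => f (step y σ))
          Measurable.of_discrete Measurable.of_discrete).integral_mul_eq_mul_integral
          ((Measurable.of_discrete
            (f := fun τ : Fin n → Fin n => if τ = σ then (1 : ℝ) else 0)).comp
            (measurable_pi_apply t)).aestronglyMeasurable
          (integrable_opinions s t (fun y => f (step y σ)) x).aestronglyMeasurable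
        rw [integral_const_mul, ← hlaw σ]
        exact this
    _ = mean s t (nextMean s f) x := by
        rw [← integral_finsetSum _ fun σ _ =>
          (integrable_opinions s t (fun y => f (step y σ)) x).const_mul _]
        refine integral_congr_ae (ae_of_all _ fun ω => ?_)
        simp [nextMean, integral_fintype (integrable_stepLaw s _)]

theorem mean_zero (s : Sampling) (f : (Fin n → ℤ) → ℝ) (x : Fin n → ℤ) : mean s 0 f x = f x := by
  simp [mean, opinions]

theorem mean_add_time (s : Sampling) (t u : ℕ) (f : (Fin n → ℤ) → ℝ) (x : Fin n → ℤ) :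
    mean s (t + u) f x = mean s t (mean s u f) x := by
  induction u generalizing f with
  | zero => congr 1; ext y; rw [mean_zero]
  | succ u ih =>
    rw [← add_assoc, mean_succ, ih]
    congr 1
    ext y
    rw [mean_succ]

theorem mean_mono_on (s : Sampling) {D : Set (Fin n → ℤ)} (hD : ∀ x ∈ D, ∀ σ, step x σ ∈ D)
    {f g : (Fin n → ℤ) → ℝ} (h : ∀ x ∈ D, f x ≤ g x) (t : ℕ) {x : Fin n → ℤ} (hx : x ∈ D) :
    mean s t f x ≤ mean s t g x :=
  integral_mono (integrable_opinions s t f x) (integrable_opinions s t g x)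
    fun ω => h _ (opinions_mem hD hx ω t)

theorem mean_mono (s : Sampling) {f g : (Fin n → ℤ) → ℝ} (h : ∀ x, f x ≤ g x) (t : ℕ)
    (x : Fin n → ℤ) : mean s t f x ≤ mean s t g x :=
  mean_mono_on s (D := Set.univ) (fun _ _ _ => trivial) (fun x _ => h x) t trivial

theorem mean_add (s : Sampling) (t : ℕ) (f g : (Fin n → ℤ) → ℝ) (x : Fin n → ℤ) :
    mean s t (fun y => f y + g y) x = mean s t f x + mean s t g x :=
  integral_add (integrable_opinions s t f x) (integrable_opinions s t g x)

theorem mean_sub (s : Sampling) (t : ℕ) (f g : (Fin n → ℤ) → ℝ) (x : Fin n → ℤ) :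
    mean s t (fun y => f y - g y) x = mean s t f x - mean s t g x :=
  integral_sub (integrable_opinions s t f x) (integrable_opinions s t g x)

theorem mean_const_mul (s : Sampling) (t : ℕ) (c : ℝ) (f : (Fin n → ℤ) → ℝ) (x : Fin n → ℤ) :
    mean s t (fun y => c * f y) x = c * mean s t f x :=
  integral_const_mul c _

theorem mean_div (s : Sampling) (t : ℕ) (c : ℝ) (f : (Fin n → ℤ) → ℝ) (x : Fin n → ℤ) :
    mean s t (fun y => f y / c) x = mean s t f x / c :=
  integral_div c _

theorem mean_const (s : Sampling) (t : ℕ) (c : ℝ) (x : Fin n → ℤ) :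
    mean s t (fun _ => c) x = c := by simp [mean]

theorem mean_nonneg (s : Sampling) {f : (Fin n → ℤ) → ℝ} (h : ∀ x, 0 ≤ f x) (t : ℕ)
    (x : Fin n → ℤ) : 0 ≤ mean s t f x :=
  integral_nonneg fun _ => h _

theorem mean_sq_le (s : Sampling) (t : ℕ) (f : (Fin n → ℤ) → ℝ) (x : Fin n → ℤ) :
    mean s t f x ^ 2 ≤ mean s t (fun y => f y ^ 2) x := by
  have h := mean_nonneg s (fun y => sq_nonneg (f y - mean s t f x)) t x
  have h2 : mean s t (fun y => (f y - mean s t f x) ^ 2) x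
      = mean s t (fun y => f y ^ 2 + ((-2 * mean s t f x) * f y + mean s t f x ^ 2)) x := by
    congr 1; ext y; ring
  rw [h2, mean_add, mean_add, mean_const_mul, mean_const] at h
  nlinarith

/-- If `V ≥ 0` drops on average by at least `g` in each step, then the sum of the means of `g` is at
most the initial value of `V`. -/
theorem sum_mean_le_of_drift (s : Sampling) {V g : (Fin n → ℤ) → ℝ} (hV : ∀ x, 0 ≤ V x)
    (h : ∀ x, nextMean s V x ≤ V x - g x) (N : ℕ) (x : Fin n → ℤ) :
    ∑ t ∈ Finset.range N, mean s t g x ≤ V x := by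
  suffices ∑ t ∈ Finset.range N, mean s t g x ≤ V x - mean s N V x by
    have := mean_nonneg s hV N x; linarith
  induction N with
  | zero => simp [mean_zero]
  | succ N ih =>
    rw [Finset.sum_range_succ]
    have := mean_mono s h N x
    rw [← mean_succ, mean_sub] at this
    linarith

theorem mean_antitone_of_le (s : Sampling) {f : (Fin n → ℤ) → ℝ}
    (h : ∀ x, nextMean s f x ≤ f x) (x : Fin n → ℤ) : Antitone fun t => mean s t f x :=
  antitone_nat_of_succ_le fun t => by rw [mean_succ]; exact mean_mono s h t x

theorem nextMean_add (s : Sampling) (f g : (Fin n → ℤ) → ℝ) (x : Fin n → ℤ) :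
    nextMean s (fun y => f y + g y) x = nextMean s f x + nextMean s g x :=
  integral_add (integrable_stepLaw s _) (integrable_stepLaw s _)

theorem nextMean_const_mul (s : Sampling) (c : ℝ) (f : (Fin n → ℤ) → ℝ) (x : Fin n → ℤ) :
    nextMean s (fun y => c * f y) x = c * nextMean s f x :=
  integral_const_mul c _

theorem nextMean_const (s : Sampling) (c : ℝ) (x : Fin n → ℤ) :
    nextMean s (fun _ => c) x = c := by simp [nextMean]

theorem nextMean_le_nextMean (s : Sampling) {f g : (Fin n → ℤ) → ℝ} {x : Fin n → ℤ}
    (h : ∀ σ, f (step x σ) ≤ g (step x σ)) : nextMean s f x ≤ nextMean s g x :=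
  integral_mono (integrable_stepLaw s _) (integrable_stepLaw s _) h

theorem nextMean_sum (s : Sampling) {ι : Type*} (S : Finset ι) (f : ι → (Fin n → ℤ) → ℝ)
    (x : Fin n → ℤ) :
    nextMean s (fun y => ∑ i ∈ S, f i y) x = ∑ i ∈ S, nextMean s (f i) x :=
  integral_finsetSum _ fun _ _ => integrable_stepLaw s _

theorem nextMean_sq_le (s : Sampling) (f : (Fin n → ℤ) → ℝ) (x : Fin n → ℤ) :
    nextMean s f x ^ 2 ≤ nextMean s (fun y => f y ^ 2) x := by
  have h : ∀ g : (Fin n → ℤ) → ℝ, mean s 1 g x = nextMean s g x := fun g => by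
    rw [mean_succ s 0, mean_zero]
  rw [← h, ← h]
  exact mean_sq_le s 1 f x

end OneStep

/-! ### Moments of sums over independent vertices -/

section Moments

variable {n : ℕ}

theorem integral_choice_mul (s : Sampling) (a b : Fin n → ℝ) {v u : Fin n} (h : v ≠ u) :
    ∫ σ, a (σ v) * b (σ u) ∂stepLaw s n
      = (∫ σ, a (σ v) ∂stepLaw s n) * ∫ σ, b (σ u) ∂stepLaw s n := by
  have hi : IndepFun (fun σ : Fin n → Fin n => σ v) (fun σ => σ u) (stepLaw s n) :=
    (iIndepFun_pi (X := fun _ w => w) fun _ => Measurable.of_discrete.aemeasurable).indepFun h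
  exact hi.integral_fun_comp_mul_comp (f := a) (g := b) Measurable.of_discrete.aemeasurable
    Measurable.of_discrete.aemeasurable Measurable.of_discrete.aestronglyMeasurable
    Measurable.of_discrete.aestronglyMeasurable

/-- Off-diagonal terms factor by independence. Diagonal terms vanish on the left, where one vertex
cannot contribute to both sums, and are nonnegative on the right. -/
theorem integral_sum_mul_sum_le (s : Sampling) (a b : Fin n → Fin n → ℝ)
    (ha : ∀ v w, 0 ≤ a v w) (hb : ∀ v w, 0 ≤ b v w) (hab : ∀ v w, a v w * b v w = 0) :
    ∫ σ, (∑ v, a v (σ v)) * (∑ v, b v (σ v)) ∂stepLaw s n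
      ≤ (∫ σ, ∑ v, a v (σ v) ∂stepLaw s n) * ∫ σ, ∑ v, b v (σ v) ∂stepLaw s n := by
  simp_rw [Finset.sum_mul_sum]
  rw [integral_finsetSum _ fun _ _ => integrable_stepLaw s _,
    integral_finsetSum _ fun _ _ => integrable_stepLaw s _,
    integral_finsetSum _ fun _ _ => integrable_stepLaw s _, Finset.sum_mul_sum]
  refine Finset.sum_le_sum fun v _ => ?_
  rw [integral_finsetSum _ fun _ _ => integrable_stepLaw s _]
  refine Finset.sum_le_sum fun u _ => ?_
  rcases eq_or_ne v u with rfl | h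
  · simp only [hab, integral_zero]
    exact mul_nonneg (integral_nonneg fun _ => ha _ _) (integral_nonneg fun _ => hb _ _)
  · rw [integral_choice_mul s (a v) (b u) h]

/-- The second and third moments of a sum of independent centred variables are additive. -/
theorem moments_sum (s : Sampling) (X : Fin n → Fin n → ℝ)
    (hX : ∀ v, ∫ σ, X v (σ v) ∂stepLaw s n = 0) (S : Finset (Fin n)) :
    ∫ σ, (∑ v ∈ S, X v (σ v)) ∂stepLaw s n = 0 ∧
    ∫ σ, (∑ v ∈ S, X v (σ v)) ^ 2 ∂stepLaw s n = ∑ v ∈ S, ∫ σ, X v (σ v) ^ 2 ∂stepLaw s n ∧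
    ∫ σ, (∑ v ∈ S, X v (σ v)) ^ 3 ∂stepLaw s n = ∑ v ∈ S, ∫ σ, X v (σ v) ^ 3 ∂stepLaw s n := by
  induction S using Finset.induction_on with
  | empty => simp
  | insert a S ha ih =>
    obtain ⟨ih1, ih2, ih3⟩ := ih
    have hi : IndepFun (fun σ : Fin n → Fin n => ∑ v ∈ S, X v (σ v)) (fun σ => X a (σ a))
        (stepLaw s n) := by
      have := (iIndepFun_choice s X).indepFun_finsetSum_of_notMem
        (fun _ => Measurable.of_discrete) ha
      convert this using 1
      ext σ; simp
    have hmul : ∀ i j : ℕ, ∫ σ, (∑ v ∈ S, X v (σ v)) ^ i * X a (σ a) ^ j ∂stepLaw s n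
        = (∫ σ, (∑ v ∈ S, X v (σ v)) ^ i ∂stepLaw s n) * ∫ σ, X a (σ a) ^ j ∂stepLaw s n :=
      fun i j => hi.integral_fun_comp_mul_comp (f := fun x => x ^ i) (g := fun x => x ^ j)
        Measurable.of_discrete.aemeasurable
        Measurable.of_discrete.aemeasurable (by fun_prop) (by fun_prop)
    have I : ∀ g : (Fin n → Fin n) → ℝ, Integrable g (stepLaw s n) := integrable_stepLaw s
    simp_rw [Finset.sum_insert ha]
    have h11 := hmul 1 1
    have h21 := hmul 2 1
    have h12 := hmul 1 2
    simp only [pow_one, ih1, hX a, mul_zero, zero_mul] at h11 h21 h12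
    refine ⟨?_, ?_, ?_⟩
    · rw [integral_add (I _) (I _), ih1, hX a, add_zero]
    · have : ∀ σ : Fin n → Fin n, (X a (σ a) + ∑ v ∈ S, X v (σ v)) ^ 2
          = (X a (σ a) ^ 2 + (∑ v ∈ S, X v (σ v)) ^ 2)
            + 2 * ((∑ v ∈ S, X v (σ v)) * X a (σ a)) := fun σ => by ring
      simp_rw [this]
      rw [integral_add (I _) (I _), integral_add (I _) (I _), integral_const_mul, h11, ih2]
      ring
    · have : ∀ σ : Fin n → Fin n, (X a (σ a) + ∑ v ∈ S, X v (σ v)) ^ 3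
          = (X a (σ a) ^ 3 + (∑ v ∈ S, X v (σ v)) ^ 3)
            + (3 * ((∑ v ∈ S, X v (σ v)) ^ 2 * X a (σ a))
            + 3 * ((∑ v ∈ S, X v (σ v)) * X a (σ a) ^ 2)) := fun σ => by ring
      simp_rw [this]
      rw [integral_add (I _) (I _), integral_add (I _) (I _), integral_add (I _) (I _),
        integral_const_mul, integral_const_mul, h21, h12, ih3]
      ring

end Moments

/-! ### Convex supermartingales and the martingale of the sum -/

section Drift

variable {n : ℕ}

theorem update_self (a : ℤ) : update a a = a := by simp [update]

theorem update_neg (a b : ℤ) : update (-a) (-b) = -update a b := by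
  unfold update; split_ifs <;> omega

theorem step_neg {V : Type*} (x : V → ℤ) (σ : V → V) : step (-x) σ = -step x σ := by
  ext v; exact update_neg _ _

theorem opinions_neg {V : Type*} (x : V → ℤ) (ω : ℕ → V → V) (t : ℕ) :
    opinions (-x) ω t = -opinions x ω t := by
  induction t with
  | zero => rfl
  | succ t ih => rw [opinions_succ, opinions_succ, ih, step_neg]

theorem mean_neg (s : Sampling) (t : ℕ) (f : (Fin n → ℤ) → ℝ) (x : Fin n → ℤ) :
    mean s t f (-x) = mean s t (fun y => f (-y)) x := by
  simp [mean, opinions_neg]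

theorem nextMean_neg (s : Sampling) (f : (Fin n → ℤ) → ℝ) (x : Fin n → ℤ) :
    nextMean s f (-x) = nextMean s (fun y => f (-y)) x := by
  simp [nextMean, step_neg]

theorem sub_deficit_pos (s : Sampling) (hn : 2 ≤ n) : 0 < (n : ℝ) - deficit s := by
  have := deficit_le_one s
  have : (2 : ℝ) ≤ n := by exact_mod_cast hn
  linarith

/-- Observing oneself changes nothing, so the two sampling conventions differ only in the
denominator. -/
theorem nextMean_vertex (s : Sampling) (hn : 2 ≤ n) (φ : ℤ → ℝ) (x : Fin n → ℤ) (v : Fin n) :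
    nextMean s (fun y => φ (y v)) x
      = φ (x v) + (∑ w, (φ (update (x v) (x w)) - φ (x v))) / (n - deficit s) := by
  have h := integral_choice s hn v (fun w => φ (update (x v) (x w)))
  have hm := (sub_deficit_pos s hn).ne'
  rw [nextMean]
  simp only [step] at h ⊢
  rw [h, update_self, Finset.sum_sub_distrib]
  simp
  field_simp
  ring

/-- Symmetrizing the double sum groups the changes of v observing w and of w observing v, which move
two opinions towards each other. -/
theorem nextMean_sum_vertex (s : Sampling) (hn : 2 ≤ n) (φ : ℤ → ℝ) (x : Fin n → ℤ) :
    nextMean s (fun y => ∑ v, φ (y v)) x = ∑ v, φ (x v)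
      + (∑ v, ∑ w, (φ (update (x v) (x w)) - φ (x v)
          + (φ (update (x w) (x v)) - φ (x w)))) / (2 * (n - deficit s)) := by
  have h2 : ∑ v, ∑ w, (φ (update (x w) (x v)) - φ (x w))
      = ∑ v, ∑ w, (φ (update (x v) (x w)) - φ (x v)) := Finset.sum_comm
  simp_rw [Finset.sum_add_distrib]
  rw [nextMean_sum, h2]
  simp_rw [nextMean_vertex s hn]
  rw [Finset.sum_add_distrib, ← Finset.sum_div]
  have hm := (sub_deficit_pos s hn).ne'
  field_simp
  ring

/-- The sum of a convex function of the opinions is a supermartingale. -/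
theorem nextMean_sum_le_of_convex (s : Sampling) (hn : 2 ≤ n) (φ : ℤ → ℝ)
    (hφ : ∀ a b, a < b → φ (a + 1) + φ (b - 1) ≤ φ a + φ b) (x : Fin n → ℤ) :
    nextMean s (fun y => ∑ v, φ (y v)) x ≤ ∑ v, φ (x v) := by
  rw [nextMean_sum_vertex s hn]
  have hm := sub_deficit_pos s hn
  have : (∑ v, ∑ w, (φ (update (x v) (x w)) - φ (x v)
      + (φ (update (x w) (x v)) - φ (x w)))) / (2 * (n - deficit s)) ≤ 0 := by
    refine div_nonpos_of_nonpos_of_nonneg ?_ (by positivity)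
    refine Finset.sum_nonpos fun v _ => Finset.sum_nonpos fun w _ => ?_
    rcases lt_trichotomy (x v) (x w) with h | h | h
    · have := hφ _ _ h
      simp only [update, h, h.not_gt, if_true, if_false]; linarith
    · simp [h, update_self]
    · have := hφ _ _ h
      simp only [update, h, h.not_gt, if_true, if_false]; linarith
  linarith

/-- The sum of the opinions is a martingale. -/
theorem nextMean_sum_opinions (s : Sampling) (hn : 2 ≤ n) (x : Fin n → ℤ) :
    nextMean s (fun y => ∑ v, (y v : ℝ)) x = ∑ v, (x v : ℝ) := by
  rw [nextMean_sum_vertex s hn (fun a => (a : ℝ))]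
  have : ∀ v w : Fin n, ((update (x v) (x w) : ℤ) : ℝ) - x v
      + (((update (x w) (x v) : ℤ) : ℝ) - x w) = 0 := by
    intro v w
    unfold update
    split_ifs <;> first | omega | (push_cast; ring)
  simp [this]

/-- The variances of the independent vertex moves add up, and each is at most the second moment of a
move in {-1, 0, 1}. -/
theorem nextMean_sq_sum_le (s : Sampling) (hn : 2 ≤ n) (c : ℝ) (x : Fin n → ℤ) :
    nextMean s (fun y => (∑ v, (y v : ℝ) - c) ^ 2) x ≤ (∑ v, (x v : ℝ) - c) ^ 2 + n := by
  set p : Fin n → ℝ := fun v => nextMean s (fun y => (y v : ℝ)) x with hp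
  set X : Fin n → Fin n → ℝ := fun v w => (update (x v) (x w) : ℝ) - p v with hXdef
  have I : ∀ g : (Fin n → Fin n) → ℝ, Integrable g (stepLaw s n) := integrable_stepLaw s
  have hX : ∀ v, ∫ σ, X v (σ v) ∂stepLaw s n = 0 := fun v => by
    simp only [hXdef]
    rw [integral_sub (I _) (I _)]
    simp [hp, nextMean, step]
  have hsum : ∑ v, p v = ∑ v, (x v : ℝ) := by
    rw [← nextMean_sum_opinions s hn, nextMean_sum]
  obtain ⟨h1, h2, -⟩ := moments_sum s X hX Finset.univ
  have e : ∀ σ : Fin n → Fin n, (∑ v, (step x σ v : ℝ) - c) ^ 2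
      = (∑ v, X v (σ v)) ^ 2 + (2 * (∑ v, (x v : ℝ) - c) * (∑ v, X v (σ v))
        + (∑ v, (x v : ℝ) - c) ^ 2) := by
    intro σ
    have : ∑ v, (step x σ v : ℝ) = ∑ v, X v (σ v) + ∑ v, (x v : ℝ) := by
      rw [← hsum, ← Finset.sum_add_distrib]
      simp [hXdef, step]
    rw [this]; ring
  rw [nextMean]
  simp_rw [e]
  rw [integral_add (I _) (I _), integral_add (I _) (I _), integral_const_mul, h1, h2]
  have h3 : ∀ v, ∫ σ, X v (σ v) ^ 2 ∂stepLaw s n ≤ 1 := by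
    intro v
    have e : ∫ σ, ((update (x v) (x (σ v)) : ℝ) - x v) ^ 2 ∂stepLaw s n
        = ∫ σ, X v (σ v) ^ 2 ∂stepLaw s n + (p v - x v) ^ 2 := by
      have : ∀ σ : Fin n → Fin n, ((update (x v) (x (σ v)) : ℝ) - x v) ^ 2
          = X v (σ v) ^ 2 + (2 * (p v - x v) * X v (σ v) + (p v - x v) ^ 2) := by
        intro σ; simp only [hXdef]; ring
      simp_rw [this]
      rw [integral_add (I _) (I _), integral_add (I _) (I _), integral_const_mul, hX]
      simp
    have : ∫ σ, ((update (x v) (x (σ v)) : ℝ) - x v) ^ 2 ∂stepLaw s n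
        ≤ ∫ _, 1 ∂stepLaw s n := by
      refine integral_mono (I _) (I _) fun σ => ?_
      simp only [update]
      split_ifs <;> simp
    simp at this
    nlinarith [sq_nonneg (p v - x v)]
  have h4 : ∑ v, ∫ σ, X v (σ v) ^ 2 ∂stepLaw s n ≤ n := by
    simpa using Finset.sum_le_sum fun v (_ : v ∈ Finset.univ) => h3 v
  simp
  linarith

theorem mean_sq_sum_le (s : Sampling) (hn : 2 ≤ n) (t : ℕ) (x : Fin n → ℤ) :
    mean s t (fun y => (∑ v, (y v : ℝ) - ∑ v, (x v : ℝ)) ^ 2) x ≤ n * t := by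
  induction t with
  | zero => simp [mean_zero]
  | succ t ih =>
    rw [mean_succ]
    refine (mean_mono s (nextMean_sq_sum_le s hn _) t x).trans ?_
    rw [mean_add, mean_const]
    push_cast
    linarith

theorem mean_sum_opinions (s : Sampling) (hn : 2 ≤ n) (t : ℕ) (x : Fin n → ℤ) :
    mean s t (fun y => ∑ v, (y v : ℝ)) x = ∑ v, (x v : ℝ) := by
  induction t with
  | zero => simp [mean_zero]
  | succ t ih =>
    rw [mean_succ, funext (nextMean_sum_opinions s hn), ih]

end Drift

/-! ### Counts of the extreme opinions -/

section Count

variable {n : ℕ}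

/-- The number of vertices with opinion `j`. -/
noncomputable def count (x : Fin n → ℤ) (j : ℤ) : ℝ := ∑ v, if x v = j then 1 else 0

theorem count_eq_card (x : Fin n → ℤ) (j : ℤ) :
    count x j = ((Finset.univ.filter fun v => x v = j).card : ℝ) := by
  simp [count]

theorem count_nonneg (x : Fin n → ℤ) (j : ℤ) : 0 ≤ count x j := by
  rw [count_eq_card]; positivity

theorem one_le_count {x : Fin n → ℤ} {j : ℤ} {v : Fin n} (h : x v = j) : 1 ≤ count x j := by
  rw [count_eq_card, Nat.one_le_cast, Nat.one_le_iff_ne_zero, ← Nat.pos_iff_ne_zero,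
    Finset.card_pos]
  exact ⟨v, by simp [h]⟩

theorem count_eq_zero {x : Fin n → ℤ} {j : ℤ} (h : ∀ v, x v ≠ j) : count x j = 0 := by
  simp [count, h]

theorem count_eq_zero_or_one_le (x : Fin n → ℤ) (j : ℤ) : count x j = 0 ∨ 1 ≤ count x j := by
  by_cases h : ∃ v, x v = j
  · exact Or.inr (one_le_count h.choose_spec)
  · exact Or.inl (count_eq_zero fun v hv => h ⟨v, hv⟩)

theorem count_le (x : Fin n → ℤ) (j : ℤ) : count x j ≤ n := by
  rw [count_eq_card]
  exact_mod_cast (Finset.card_le_univ _).trans (by simp)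

theorem count_neg (x : Fin n → ℤ) (j : ℤ) : count (-x) j = count x (-j) := by
  simp [count, neg_eq_iff_eq_neg]

theorem sum_vertices_one : ∑ _v : Fin n, (1 : ℝ) = n := by simp

theorem count_bottom_add_top_le (x : Fin n → ℤ) {l h : ℤ} (hlh : l + 3 ≤ h) :
    count x l + count x (l + 1) + (count x h + count x (h - 1)) ≤ n := by
  rw [← sum_vertices_one (n := n)]
  simp only [count, ← Finset.sum_add_distrib]
  refine Finset.sum_le_sum fun v _ => ?_
  split_ifs <;> first | omega | norm_num

theorem count_add_three {x : Fin n → ℤ} {l : ℤ} (hx : ∀ v, x v ∈ Set.Icc l (l + 2)) :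
    count x l + count x (l + 1) + count x (l + 2) = n := by
  rw [← sum_vertices_one (n := n)]
  simp only [count, ← Finset.sum_add_distrib]
  refine Finset.sum_congr rfl fun v _ => ?_
  have := hx v
  simp only [Set.mem_Icc] at this
  split_ifs <;> first | omega | norm_num

theorem step_mem_Icc {V : Type*} {a b : ℤ} {x : V → ℤ} (hx : ∀ v, x v ∈ Set.Icc a b) (σ : V → V)
    (v : V) : step x σ v ∈ Set.Icc a b := by
  have h1 := hx v
  have h2 := hx (σ v)
  simp only [Set.mem_Icc, step, update] at *
  split_ifs <;> omega

/-- Only vertices at l or l + 1 can hold l after the step, and they do so exactly when they observe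
an l. -/
theorem nextMean_count_bottom (s : Sampling) (hn : 2 ≤ n) {x : Fin n → ℤ} {l : ℤ}
    (hx : ∀ v, l ≤ x v) :
    nextMean s (fun y => count y l) x
      = count x l * (count x l + count x (l + 1) - deficit s) / (n - deficit s) := by
  have hm := (sub_deficit_pos s hn).ne'
  have hv : ∀ v, nextMean s (fun y => if y v = l then (1 : ℝ) else 0) x
      = (if x v = l then 1 else 0) * ((count x l - deficit s) / (n - deficit s))
        + (if x v = l + 1 then 1 else 0) * (count x l / (n - deficit s)) := by
    intro v
    rw [nextMean_vertex s hn (fun a => if a = l then (1 : ℝ) else 0)]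
    have h0 := hx v
    by_cases h1 : x v = l
    · have : ∀ w, ((if update (x v) (x w) = l then (1 : ℝ) else 0) - if x v = l then 1 else 0)
          = (if x w = l then 1 else 0) - 1 := by
        intro w
        have := hx w
        unfold update
        split_ifs <;> first | omega | norm_num
      simp_rw [this]
      rw [Finset.sum_sub_distrib, sum_vertices_one, ← count]
      simp [h1]
      field_simp
      ring
    · by_cases h2 : x v = l + 1
      · have : ∀ w, ((if update (x v) (x w) = l then (1 : ℝ) else 0) - if x v = l then 1 else 0)
            = (if x w = l then 1 else 0) := by
          intro w
          have := hx w
          unfold update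
          split_ifs <;> first | omega | norm_num
        simp_rw [this]
        rw [← count]
        simp [h2]
      · have : ∀ w, ((if update (x v) (x w) = l then (1 : ℝ) else 0) - if x v = l then 1 else 0)
            = 0 := by
          intro w
          unfold update
          split_ifs <;> first | omega | norm_num
        simp_rw [this]
        simp [h1, h2]
  simp only [count] at hv ⊢
  rw [nextMean_sum]
  simp_rw [hv]
  rw [Finset.sum_add_distrib, ← Finset.sum_mul, ← Finset.sum_mul]
  field_simp
  ring

theorem nextMean_count_top (s : Sampling) (hn : 2 ≤ n) {x : Fin n → ℤ} {h : ℤ}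
    (hx : ∀ v, x v ≤ h) :
    nextMean s (fun y => count y h) x
      = count x h * (count x h + count x (h - 1) - deficit s) / (n - deficit s) := by
  have := nextMean_count_bottom s hn (x := -x) (l := -h) (fun v => by simp [hx v])
  rw [nextMean_neg] at this
  simp only [count_neg, neg_neg, show -(-h + 1) = h - 1 by ring] at this
  exact this

theorem nextMean_count_mul_count_le (s : Sampling) (x : Fin n → ℤ) {l h : ℤ} (hlh : l ≠ h) :
    nextMean s (fun y => count y l * count y h) x
      ≤ nextMean s (fun y => count y l) x * nextMean s (fun y => count y h) x := by
  refine integral_sum_mul_sum_le s (fun v w => if update (x v) (x w) = l then 1 else 0)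
    (fun v w => if update (x v) (x w) = h then 1 else 0) ?_ ?_ ?_
  · intro v w; positivity
  · intro v w; positivity
  · intro v w
    split_ifs <;> simp_all

end Count

/-! ### Reduction to three consecutive opinions -/

section Spread

variable {n : ℕ}

/-- The smallest opinion. -/
noncomputable def lo (x : Fin n → ℤ) : ℤ := ⨅ v, x v

/-- The largest opinion. -/
noncomputable def hi (x : Fin n → ℤ) : ℤ := ⨆ v, x v

theorem lo_le (x : Fin n → ℤ) (v : Fin n) : lo x ≤ x v := ciInf_le (Set.finite_range _).bddBelow v

theorem le_hi (x : Fin n → ℤ) (v : Fin n) : x v ≤ hi x := le_ciSup (Set.finite_range _).bddAbove v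

theorem mem_Icc_lo_hi (x : Fin n → ℤ) (v : Fin n) : x v ∈ Set.Icc (lo x) (hi x) :=
  ⟨lo_le x v, le_hi x v⟩

theorem exists_eq_lo (hn : 0 < n) (x : Fin n → ℤ) : ∃ v, x v = lo x := by
  have : Nonempty (Fin n) := ⟨⟨0, hn⟩⟩
  exact exists_eq_ciInf_of_finite

theorem exists_eq_hi (hn : 0 < n) (x : Fin n → ℤ) : ∃ v, x v = hi x := by
  have : Nonempty (Fin n) := ⟨⟨0, hn⟩⟩
  exact exists_eq_ciSup_of_finite

theorem le_lo_of_forall (hn : 0 < n) {x : Fin n → ℤ} {a : ℤ} (h : ∀ v, a ≤ x v) : a ≤ lo x := by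
  obtain ⟨v, hv⟩ := exists_eq_lo hn x
  exact hv ▸ h v

theorem hi_le_of_forall (hn : 0 < n) {x : Fin n → ℤ} {a : ℤ} (h : ∀ v, x v ≤ a) : hi x ≤ a := by
  obtain ⟨v, hv⟩ := exists_eq_hi hn x
  exact hv ▸ h v

theorem lo_le_hi (hn : 0 < n) (x : Fin n → ℤ) : lo x ≤ hi x :=
  (lo_le x ⟨0, hn⟩).trans (le_hi x _)

theorem lo_le_lo_step (hn : 0 < n) (x : Fin n → ℤ) (σ : Fin n → Fin n) : lo x ≤ lo (step x σ) :=
  le_lo_of_forall hn fun v => (step_mem_Icc (mem_Icc_lo_hi x) σ v).1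

theorem hi_step_le_hi (hn : 0 < n) (x : Fin n → ℤ) (σ : Fin n → Fin n) : hi (step x σ) ≤ hi x :=
  hi_le_of_forall hn fun v => (step_mem_Icc (mem_Icc_lo_hi x) σ v).2

theorem one_le_count_lo (hn : 0 < n) (x : Fin n → ℤ) : 1 ≤ count x (lo x) :=
  one_le_count (exists_eq_lo hn x).choose_spec

theorem one_le_count_hi (hn : 0 < n) (x : Fin n → ℤ) : 1 ≤ count x (hi x) :=
  one_le_count (exists_eq_hi hn x).choose_spec

/-- The two means are the old counts times factors u and w. For spread at least 3 the two lowest and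
the two highest levels are disjoint, so u + w ≤ 1 and uw ≤ 1/4. -/
theorem nextMean_extremes_le (s : Sampling) (hn : 2 ≤ n) (x : Fin n → ℤ)
    (h : lo x + 3 ≤ hi x) :
    nextMean s (fun y => count y (lo x) * count y (hi x)) x
      ≤ count x (lo x) * count x (hi x) / 4 := by
  refine (nextMean_count_mul_count_le s x (by omega)).trans ?_
  rw [nextMean_count_bottom s hn (lo_le x), nextMean_count_top s hn (le_hi x)]
  have hm := sub_deficit_pos s hn
  have h1 := one_le_count_lo (by omega) x
  have h2 := one_le_count_hi (by omega) x
  have h3 := count_nonneg x (lo x + 1)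
  have h4 := count_nonneg x (hi x - 1)
  have h5 := count_bottom_add_top_le x h
  have h6 := deficit_le_one s
  have h7 := deficit_nonneg s
  set a := count x (lo x)
  set b := count x (hi x)
  set m := (n : ℝ) - deficit s with hmdef
  have hu : 0 ≤ (a + count x (lo x + 1) - deficit s) / m := div_nonneg (by linarith) hm.le
  have hw : 0 ≤ (b + count x (hi x - 1) - deficit s) / m := div_nonneg (by linarith) hm.le
  have huw : (a + count x (lo x + 1) - deficit s) / m
      + (b + count x (hi x - 1) - deficit s) / m ≤ 1 := by
    rw [← add_div, div_le_one hm]; linarith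
  rw [mul_div_assoc, mul_div_assoc]
  set u := (a + count x (lo x + 1) - deficit s) / m
  set w := (b + count x (hi x - 1) - deficit s) / m
  have : u * w ≤ 1 / 4 := by nlinarith [sq_nonneg (u - w)]
  calc a * u * (b * w) = a * b * (u * w) := by ring
    _ ≤ a * b * (1 / 4) := by gcongr
    _ = a * b / 4 := by ring

/-- The product of the numbers of vertices with the two extreme opinions, weighted exponentially in
the spread; it is set to `0` when at most three consecutive opinions are left. -/
noncomputable def extremePotential (x : Fin n → ℤ) : ℝ :=
  if lo x + 3 ≤ hi x then
    count x (lo x) * count x (hi x) * (4 * (n : ℝ) ^ 2) ^ (hi x - lo x).toNat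
  else 0

/-- If both extremes survive, the product of counts contracts by 4 in mean; otherwise the lost
factor 4n² of the weight outweighs any product of counts. Each case costs at most a quarter of the
potential, as the product of counts is at least 1. -/
theorem nextMean_extremePotential_le (s : Sampling) (hn : 2 ≤ n) (x : Fin n → ℤ) :
    nextMean s extremePotential x ≤ extremePotential x / 2 := by
  have hn0 : 0 < n := by omega
  have hnR : (2 : ℝ) ≤ n := by exact_mod_cast hn
  by_cases h : lo x + 3 ≤ hi x
  · set M : ℝ := 4 * (n : ℝ) ^ 2 with hM
    have hM1 : 1 ≤ M := by nlinarith
    set d := (hi x - lo x).toNat with hd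
    have hpt : ∀ σ, extremePotential (step x σ)
        ≤ M ^ d * (count (step x σ) (lo x) * count (step x σ) (hi x)) + M ^ d / 4 := by
      intro σ
      have h1 := lo_le_lo_step hn0 x σ
      have h2 := hi_step_le_hi hn0 x σ
      have hp : 0 ≤ M ^ d * (count (step x σ) (lo x) * count (step x σ) (hi x)) :=
        mul_nonneg (by positivity) (mul_nonneg (count_nonneg _ _) (count_nonneg _ _))
      rw [extremePotential]
      split_ifs with h3
      · by_cases h4 : lo (step x σ) = lo x ∧ hi (step x σ) = hi x
        · rw [h4.1, h4.2, mul_comm]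
          have : 0 ≤ M ^ d / 4 := by positivity
          linarith
        -- An extreme opinion has died out: the new potential is at most n² M^(d-1) = M^d / 4.
        · obtain ⟨e, he⟩ : ∃ e, d = e + 1 := ⟨d - 1, by omega⟩
          have h5 : M ^ (hi (step x σ) - lo (step x σ)).toNat ≤ M ^ e :=
            pow_le_pow_right₀ hM1 (by omega)
          have h6 : count (step x σ) (lo (step x σ)) * count (step x σ) (hi (step x σ))
              ≤ (n : ℝ) * n :=
            mul_le_mul (count_le _ _) (count_le _ _) (count_nonneg _ _) (by positivity)
          have h7 : M ^ d / 4 = n * n * M ^ e := by rw [he, pow_succ]; simp only [hM]; ring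
          have := mul_le_mul h6 h5 (by positivity) (by positivity)
          linarith
      · have : 0 ≤ M ^ d / 4 := by positivity
        linarith
    have h1 := one_le_count_lo hn0 x
    have h2 := one_le_count_hi hn0 x
    have h3 := nextMean_extremes_le s hn x h
    refine (nextMean_le_nextMean s (g := fun y =>
      M ^ d * (count y (lo x) * count y (hi x)) + M ^ d / 4) hpt).trans ?_
    rw [nextMean_add, nextMean_const_mul, nextMean_const, extremePotential, if_pos h, ← hd]
    have hMd : 0 < M ^ d := by positivity
    have h4 : 1 ≤ count x (lo x) * count x (hi x) := one_le_mul_of_one_le_of_one_le h1 h2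
    nlinarith
  · have : ∀ σ, extremePotential (step x σ) ≤ 0 := by
      intro σ
      have h1 := lo_le_lo_step hn0 x σ
      have h2 := hi_step_le_hi hn0 x σ
      rw [extremePotential, if_neg (by omega)]
    refine (nextMean_le_nextMean s (g := fun _ => 0) this).trans ?_
    rw [nextMean_const, extremePotential, if_neg h]
    simp

theorem indicator_spread_le_extremePotential (hn : 2 ≤ n) (x : Fin n → ℤ) :
    (if lo x + 3 ≤ hi x then (1 : ℝ) else 0) ≤ extremePotential x := by
  have hnR : (2 : ℝ) ≤ n := by exact_mod_cast hn
  rw [extremePotential]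
  split_ifs
  · have h1 := one_le_count_lo (by omega) x
    have h2 := one_le_count_hi (by omega) x
    exact one_le_mul_of_one_le_of_one_le (one_le_mul_of_one_le_of_one_le h1 h2)
      (one_le_pow₀ (by nlinarith))
  · rfl

/-- The probability that more than three consecutive opinions are needed decays exponentially. -/
theorem mean_indicator_spread_le (s : Sampling) (hn : 2 ≤ n) (k : ℕ) (x : Fin n → ℤ)
    (hk : hi x - lo x + 1 ≤ k) (t : ℕ) :
    mean s t (fun y => if lo y + 3 ≤ hi y then (1 : ℝ) else 0) x
      ≤ (4 * (n : ℝ) ^ 2) ^ k / 2 ^ t := by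
  have hnR : (2 : ℝ) ≤ n := by exact_mod_cast hn
  refine (mean_mono s (indicator_spread_le_extremePotential hn) t x).trans ?_
  have h0 : extremePotential x ≤ (4 * (n : ℝ) ^ 2) ^ k := by
    rw [extremePotential]
    split_ifs with h
    · obtain ⟨e, rfl⟩ : ∃ e, k = e + 1 := ⟨k - 1, by omega⟩
      have h1 : count x (lo x) * count x (hi x) ≤ (n : ℝ) * n :=
        mul_le_mul (count_le _ _) (count_le _ _) (count_nonneg _ _) (by positivity)
      have h2 : (4 * (n : ℝ) ^ 2) ^ (hi x - lo x).toNat ≤ (4 * (n : ℝ) ^ 2) ^ e :=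
        pow_le_pow_right₀ (by nlinarith) (by omega)
      have := mul_le_mul h1 h2 (by positivity) (by positivity)
      rw [pow_succ (4 * (n : ℝ) ^ 2) e]
      have h3 : 0 ≤ (4 * (n : ℝ) ^ 2) ^ e := by positivity
      nlinarith
    · positivity
  induction t with
  | zero => simpa [mean_zero] using h0
  | succ t ih =>
    rw [mean_succ]
    refine (mean_mono s (nextMean_extremePotential_le s hn) t x).trans ?_
    rw [mean_div, pow_succ (2 : ℝ) t, ← div_div]
    gcongr

end Spread

/-! ### The phase with three opinions -/

section ThreeOpinions

variable {n : ℕ}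

/-- The geometric mean of the numbers of vertices with opinions `l` and `l + 2`. -/
noncomputable def outerMean (l : ℤ) (x : Fin n → ℤ) : ℝ := √(count x l * count x (l + 2))

theorem outerMean_nonneg (l : ℤ) (x : Fin n → ℤ) : 0 ≤ outerMean l x := Real.sqrt_nonneg _

theorem outerMean_sq (l : ℤ) (x : Fin n → ℤ) :
    outerMean l x ^ 2 = count x l * count x (l + 2) :=
  Real.sq_sqrt (mul_nonneg (count_nonneg _ _) (count_nonneg _ _))

/-- By Cauchy–Schwarz and negative correlation, the squared mean is at most Y²(1 - A/m)(1 - B/m).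
Since A + B ≥ 2√(AB) = 2Y, this is at most Y²(1 - Y/m)². -/
theorem nextMean_outerMean_le (s : Sampling) (hn : 2 ≤ n) {l : ℤ} {x : Fin n → ℤ}
    (hx : ∀ v, x v ∈ Set.Icc l (l + 2)) :
    nextMean s (outerMean l) x ≤ outerMean l x - outerMean l x ^ 2 / (n - deficit s) := by
  have hm := sub_deficit_pos s hn
  have h1 : nextMean s (outerMean l) x ^ 2
      ≤ nextMean s (fun y => count y l) x * nextMean s (fun y => count y (l + 2)) x := by
    refine (nextMean_sq_le s _ x).trans ?_
    simp_rw [outerMean_sq]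
    exact nextMean_count_mul_count_le s x (by omega)
  rw [nextMean_count_bottom s hn fun v => (hx v).1,
    nextMean_count_top s hn fun v => (hx v).2] at h1
  have h2 := count_add_three hx
  have h3 := outerMean_sq l x
  have hY := outerMean_nonneg l x
  have hd := deficit_le_one s
  rw [show l + 2 - 1 = l + 1 by ring] at h1
  have hc := count_nonneg x (l + 1)
  have hA := count_eq_zero_or_one_le x l
  have hB := count_eq_zero_or_one_le x (l + 2)
  set A := count x l
  set B := count x (l + 2)
  set Y := outerMean l x
  set m := (n : ℝ) - deficit s with hmdef
  have e1 : A + count x (l + 1) - deficit s = m - B := by linarith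
  have e2 : B + count x (l + 1) - deficit s = m - A := by linarith
  rw [e1, e2] at h1
  have h4 : nextMean s (outerMean l) x ^ 2 ≤ (Y * (1 - Y / m)) ^ 2 ∧ 0 ≤ Y * (1 - Y / m) := by
    have e3 : A * (m - B) / m * (B * (m - A) / m) = Y ^ 2 * ((1 - A / m) * (1 - B / m)) := by
      rw [h3]; field_simp
    -- A count may equal n > m when self-sampling is excluded, but then the other outer count is 0
    -- and Y = 0. If both are at least 1, both are at most m.
    rcases hA with hA | hA
    · have : Y = 0 := by simpa [hA] using h3
      simpa [this, hA] using h1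
    · rcases hB with hB | hB
      · have : Y = 0 := by simpa [hB] using h3
        simpa [this, hB] using h1
      · have hAm : A ≤ m := by linarith
        have hBm : B ≤ m := by linarith
        have hYm : Y ≤ m := by nlinarith
        have hq : (Y / m) ^ 2 = A / m * (B / m) := by rw [div_pow, h3]; field_simp
        have ha : A / m ≤ 1 := (div_le_one hm).2 hAm
        have hb : B / m ≤ 1 := (div_le_one hm).2 hBm
        have ha0 : 0 ≤ A / m := div_nonneg (by linarith) hm.le
        have hb0 : 0 ≤ B / m := div_nonneg (by linarith) hm.le
        have hy : Y / m ≤ 1 := (div_le_one hm).2 hYm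
        have hy0 : 0 ≤ Y / m := div_nonneg hY hm.le
        refine ⟨h1.trans ?_, mul_nonneg hY (by linarith)⟩
        rw [e3, mul_pow]
        refine mul_le_mul_of_nonneg_left ?_ (sq_nonneg _)
        have h2y : 2 * (Y / m) ≤ A / m + B / m := by
          refine abs_le_of_sq_le_sq' ?_ (by linarith) |>.2
          nlinarith [sq_nonneg (A / m - B / m)]
        nlinarith
  have := abs_le_of_sq_le_sq' h4.1 h4.2 |>.2
  calc _ ≤ _ := this
    _ = _ := by ring

theorem outerMean_le (s : Sampling) (hn : 2 ≤ n) {l : ℤ} {x : Fin n → ℤ}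
    (hx : ∀ v, x v ∈ Set.Icc l (l + 2)) : outerMean l x ≤ n - deficit s := by
  have hm := sub_deficit_pos s hn
  have h2 := count_add_three hx
  have h3 := outerMean_sq l x
  have hd := deficit_le_one s
  have hc := count_nonneg x (l + 1)
  have hY := outerMean_nonneg l x
  rcases count_eq_zero_or_one_le x l with hA | hA
  · have : outerMean l x = 0 := by simpa [hA] using h3
    linarith
  · rcases count_eq_zero_or_one_le x (l + 2) with hB | hB
    · have : outerMean l x = 0 := by simpa [hB] using h3
      linarith
    · nlinarith

/-- By Jensen the means satisfy y' ≤ y - y²/m, the discrete form of dy/dt = -y²/m, whose solution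
from y(0) = m is m/(t + 1). -/
theorem mean_outerMean_le (s : Sampling) (hn : 2 ≤ n) {l : ℤ} {x : Fin n → ℤ}
    (hx : ∀ v, x v ∈ Set.Icc l (l + 2)) (t : ℕ) :
    mean s t (outerMean l) x ≤ (n - deficit s) / (t + 1) := by
  have hm := sub_deficit_pos s hn
  set m := (n : ℝ) - deficit s with hmdef
  have hrec : ∀ t, mean s (t + 1) (outerMean l) x
      ≤ mean s t (outerMean l) x - mean s t (outerMean l) x ^ 2 / m := by
    intro t
    rw [mean_succ]
    have h1 := mean_mono_on s (D := {y : Fin n → ℤ | ∀ v, y v ∈ Set.Icc l (l + 2)})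
      (fun y hy σ => step_mem_Icc hy σ) (fun y hy => nextMean_outerMean_le s hn hy) t hx
    rw [mean_sub, mean_div] at h1
    have h2 := div_le_div_of_nonneg_right (mean_sq_le s t (outerMean l) x) hm.le
    linarith
  induction t with
  | zero => simpa [mean_zero] using outerMean_le s hn hx
  | succ t ih =>
    refine (hrec t).trans ?_
    set y := mean s t (outerMean l) x
    rw [le_div_iff₀ (by positivity)] at ih
    rw [le_div_iff₀ (by positivity)]
    push_cast
    have e : y - y ^ 2 / m = (y * m - y ^ 2) / m := by field_simp
    rw [e, div_mul_eq_mul_div, div_le_iff₀ hm]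
    have ht : (0 : ℝ) ≤ t := t.cast_nonneg
    rcases Nat.eq_zero_or_pos t with h0 | h0
    · subst h0
      simp only [Nat.cast_zero]
      nlinarith [sq_nonneg (m - 2 * y)]
    · have ht1 : (1 : ℝ) ≤ t := by exact_mod_cast h0
      -- With d the slack of the induction hypothesis, the claim reads d² + t·d·y + y² ≥ 0.
      set d := m - y * (t + 1) with hdef
      have hd : 0 ≤ d := by linarith
      have : m = d + y * (t + 1) := by linarith
      rw [this]
      nlinarith [mul_nonneg hd hd, sq_nonneg y, sq_nonneg (d - y), mul_nonneg ht hd,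
        mul_nonneg (by linarith : (0:ℝ) ≤ t - 1) (sq_nonneg (d - y)), sq_nonneg (d + t * y)]

/-- A potential that controls the time during which the smallest and the largest opinion differ by
exactly two. -/
noncomputable def threePotential (s : Sampling) (x : Fin n → ℤ) : ℝ :=
  if lo x + 3 ≤ hi x then 2 * (n - deficit s)
  else if hi x = lo x + 2 then (n - deficit s) * (2 - 1 / outerMean (lo x) x) else 0

theorem one_le_outerMean (hn : 0 < n) {x : Fin n → ℤ} (h : hi x = lo x + 2) :
    1 ≤ outerMean (lo x) x := by
  have h1 := one_le_count_lo hn x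
  have h2 := one_le_count_hi hn x
  rw [h] at h2
  rw [outerMean, Real.one_le_sqrt]
  exact one_le_mul_of_one_le_of_one_le h1 h2

theorem threePotential_nonneg (s : Sampling) (hn : 2 ≤ n) (x : Fin n → ℤ) :
    0 ≤ threePotential s x := by
  have hm := sub_deficit_pos s hn
  rw [threePotential]
  split_ifs with h1 h2
  · positivity
  · have := one_le_outerMean (by omega) h2
    have : 1 / outerMean (lo x) x ≤ 1 := (div_le_one (by linarith)).2 this
    exact mul_nonneg hm.le (by linarith)
  · rfl

theorem threePotential_le (s : Sampling) (hn : 2 ≤ n) (x : Fin n → ℤ) :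
    threePotential s x ≤ 2 * n := by
  have hm := sub_deficit_pos s hn
  have hd := deficit_nonneg s
  rw [threePotential]
  split_ifs with h1 h2
  · linarith
  · have : 0 ≤ 1 / outerMean (lo x) x := div_nonneg zero_le_one (outerMean_nonneg _ _)
    nlinarith
  · positivity

/-- The function m(2 - 1/Y) has derivative m/Y², which turns the loss Y²/m of Y into a loss of 1.
The value 2m for larger spreads is the supremum, so nothing is gained on entering this phase. -/
theorem nextMean_threePotential_le (s : Sampling) (hn : 2 ≤ n) (x : Fin n → ℤ) :
    nextMean s (threePotential s) x
      ≤ threePotential s x - if hi x = lo x + 2 then 1 else 0 := by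
  have hm := sub_deficit_pos s hn
  have hn0 : 0 < n := by omega
  by_cases h3 : lo x + 3 ≤ hi x
  · rw [if_neg (by omega), sub_zero]
    refine (nextMean_le_nextMean s (g := fun _ => 2 * (n - deficit s)) fun σ => ?_).trans ?_
    · rw [threePotential]
      split_ifs with h1 h2
      · rfl
      · have : 0 ≤ 1 / outerMean (lo (step x σ)) (step x σ) :=
          div_nonneg zero_le_one (outerMean_nonneg _ _)
        nlinarith
      · positivity
    · rw [nextMean_const, threePotential, if_pos h3]
  · by_cases h2 : hi x = lo x + 2
    · have hx : ∀ v, x v ∈ Set.Icc (lo x) (lo x + 2) := h2 ▸ mem_Icc_lo_hi x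
      have hY1 := one_le_outerMean hn0 h2
      have hdrift := nextMean_outerMean_le s hn hx
      rw [if_pos h2, threePotential, if_neg h3, if_pos h2]
      set m := (n : ℝ) - deficit s with hmdef
      set Y := outerMean (lo x) x
      have hY0 : 0 < Y := by linarith
      have hinv : 1 / Y ≤ 1 := (div_le_one hY0).2 hY1
      -- The comparison function is the tangent line of the concave function u ↦ m(2 - 1/u) at u =
      -- Y.
      refine (nextMean_le_nextMean s (g := fun y => m * (2 - 2 / Y) +
        m / Y ^ 2 * outerMean (lo x) y) fun σ => ?_).trans ?_
      · have h1 := lo_le_lo_step hn0 x σ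
        have h4 := hi_step_le_hi hn0 x σ
        have h5 := lo_le_hi hn0 (step x σ)
        rw [threePotential, if_neg (by omega)]
        split_ifs with h6
        · have h7 : lo (step x σ) = lo x := by omega
          have hu := one_le_outerMean hn0 h6
          rw [h7] at hu ⊢
          set u := outerMean (lo x) (step x σ)
          have hu0 : 0 < u := by linarith
          have : m * (2 - 2 / Y) + m / Y ^ 2 * u - m * (2 - 1 / u)
              = m * ((u - Y) ^ 2 / (u * Y ^ 2)) := by
            field_simp; ring
          have : 0 ≤ m * ((u - Y) ^ 2 / (u * Y ^ 2)) := by positivity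
          linarith
        -- The phase has ended and the potential is 0; the tangent line is still nonnegative there
        -- because Y ≥ 1, which dictates the constant 2.
        · have e : 2 / Y = 2 * (1 / Y) := by ring
          have h8 : 0 ≤ m * (2 - 2 / Y) := mul_nonneg hm.le (by rw [e]; linarith)
          have h9 : 0 ≤ m / Y ^ 2 * outerMean (lo x) (step x σ) :=
            mul_nonneg (by positivity) (outerMean_nonneg _ _)
          linarith
      · rw [nextMean_add, nextMean_const, nextMean_const_mul]
        have := mul_le_mul_of_nonneg_left hdrift (by positivity : 0 ≤ m / Y ^ 2)
        have e : m / Y ^ 2 * (Y - Y ^ 2 / m) = m / Y - 1 := by field_simp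
        have e2 : m * (2 - 2 / Y) + (m / Y - 1) = m * (2 - 1 / Y) - 1 := by ring
        have e3 : nextMean s (fun y => outerMean (lo x) y) x = nextMean s (outerMean (lo x)) x :=
          rfl
        linarith
    · rw [if_neg h2, sub_zero, threePotential, if_neg h3, if_neg h2]
      refine (nextMean_le_nextMean s (g := fun _ => 0) fun σ => ?_).trans ?_
      · have h1 := lo_le_lo_step hn0 x σ
        have h4 := hi_step_le_hi hn0 x σ
        rw [threePotential, if_neg (by omega), if_neg (by omega)]
      · rw [nextMean_const]

end ThreeOpinions

/-! ### The phase with two opinions -/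

section TwoOpinions

variable {n : ℕ}

/-- The right side is the third Taylor polynomial at A. In terms of z = √u and a = √A the difference
has the explicit factor (z - a)⁴. -/
theorem sqrt_le_cubic {u A : ℝ} (hu : 0 ≤ u) (hA : 0 < A) :
    √u ≤ √A + (u - A) / (2 * √A) - (u - A) ^ 2 / (8 * √A ^ 3) + (u - A) ^ 3 / (16 * √A ^ 5) := by
  obtain ⟨z, hz, rfl⟩ : ∃ z, 0 ≤ z ∧ u = z ^ 2 :=
    ⟨√u, Real.sqrt_nonneg u, (Real.sq_sqrt hu).symm⟩
  obtain ⟨a, ha, rfl⟩ : ∃ a, 0 < a ∧ A = a ^ 2 :=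
    ⟨√A, Real.sqrt_pos.2 hA, (Real.sq_sqrt hA.le).symm⟩
  rw [Real.sqrt_sq hz, Real.sqrt_sq ha.le]
  have e : a + (z ^ 2 - a ^ 2) / (2 * a) - (z ^ 2 - a ^ 2) ^ 2 / (8 * a ^ 3)
      + (z ^ 2 - a ^ 2) ^ 3 / (16 * a ^ 5) - z
      = (z - a) ^ 4 * (z ^ 2 + 4 * a * z + 5 * a ^ 2) / (16 * a ^ 5) := by
    field_simp; ring
  have : 0 ≤ (z - a) ^ 4 * (z ^ 2 + 4 * a * z + 5 * a ^ 2) / (16 * a ^ 5) := by positivity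
  linarith

/-- The concavity gain of the square root of a nonnegative variable whose third central moment is
at most its variance. -/
theorem integral_sqrt_le (s : Sampling) {U : (Fin n → Fin n) → ℝ} (hU : ∀ σ, 0 ≤ U σ) {A W : ℝ}
    (hA : 1 ≤ A) (h1 : ∫ σ, (U σ - A) ∂stepLaw s n = 0)
    (h2 : W ≤ ∫ σ, (U σ - A) ^ 2 ∂stepLaw s n)
    (h3 : ∫ σ, (U σ - A) ^ 3 ∂stepLaw s n ≤ ∫ σ, (U σ - A) ^ 2 ∂stepLaw s n) :
    ∫ σ, √(U σ) ∂stepLaw s n ≤ √A - W / (16 * (A * √A)) := by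
  have I : ∀ g : (Fin n → Fin n) → ℝ, Integrable g (stepLaw s n) := integrable_stepLaw s
  have hA0 : 0 < A := by linarith
  have h := integral_mono (I _) (I _) fun σ => sqrt_le_cubic (hU σ) hA0
  rw [integral_add (I _) (I _), integral_sub (I _) (I _), integral_add (I _) (I _), integral_div,
    integral_div, integral_div, h1] at h
  simp only [integral_const, probReal_univ, one_smul, zero_div, add_zero] at h
  refine h.trans ?_
  set a := √A with ha
  have ha1 : 1 ≤ a := Real.one_le_sqrt.2 hA
  have hsq : A = a ^ 2 := (Real.sq_sqrt hA0.le).symm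
  have hV0 : 0 ≤ ∫ σ, (U σ - A) ^ 2 ∂stepLaw s n := integral_nonneg fun _ => sq_nonneg _
  set V := ∫ σ, (U σ - A) ^ 2 ∂stepLaw s n
  -- As A ≥ 1, the cubic term uses up at most half of the quadratic gain V / (8a³).
  have e1 : (∫ σ, (U σ - A) ^ 3 ∂stepLaw s n) / (16 * a ^ 5) ≤ V / (16 * a ^ 3) := by
    refine (div_le_div_of_nonneg_right h3 (by positivity)).trans ?_
    gcongr
    · norm_num
  have e2 : W / (16 * (A * a)) ≤ V / (16 * a ^ 3) := by
    rw [hsq, show a ^ 2 * a = a ^ 3 by ring]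
    gcongr
  have e3 : V / (8 * a ^ 3) = V / (16 * a ^ 3) + V / (16 * a ^ 3) := by field_simp; ring
  linarith

theorem count_add_two {x : Fin n → ℤ} {l : ℤ} (hx : ∀ v, x v ∈ Set.Icc l (l + 1)) :
    count x l + count x (l + 1) = n := by
  rw [← sum_vertices_one (n := n)]
  simp only [count, ← Finset.sum_add_distrib]
  refine Finset.sum_congr rfl fun v _ => ?_
  have := hx v
  simp only [Set.mem_Icc] at this
  split_ifs <;> first | omega | norm_num

/-- With two adjacent opinions each vertex adopts the opinion it observes. The new count is thus a
sum of independent Bernoulli variables with mean A and variance of order AB/n; its third central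
moment is at most its variance because centred Bernoulli variables are at most 1. -/
theorem nextMean_sqrt_count_bottom_le (s : Sampling) (hn : 3 ≤ n) {x : Fin n → ℤ} {l : ℤ}
    (hx : ∀ v, x v ∈ Set.Icc l (l + 1)) (hl : 1 ≤ count x l) :
    nextMean s (fun y => √(count y l)) x
      ≤ √(count x l) - count x (l + 1) / (32 * n * √(count x l)) := by
  have hm := sub_deficit_pos s (by omega : 2 ≤ n)
  have hd0 := deficit_nonneg s
  have hd1 := deficit_le_one s
  have hnR : (3 : ℝ) ≤ n := by exact_mod_cast hn
  have hAB := count_add_two hx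
  have hB := count_nonneg x (l + 1)
  have I : ∀ g : (Fin n → Fin n) → ℝ, Integrable g (stepLaw s n) := integrable_stepLaw s
  set A := count x l with hA
  set B := count x (l + 1) with hBdef
  set m := (n : ℝ) - deficit s with hmdef
  set ξ : Fin n → Fin n → ℝ := fun v w => if x w = l then 1 else 0 with hξ
  set p : Fin n → ℝ := fun v =>
    (if x v = l then 1 else 0) * ((A - deficit s) / m) + (if x v = l + 1 then 1 else 0) * (A / m)
    with hp
  have hcases : ∀ v, x v = l ∨ x v = l + 1 := fun v => by
    have := hx v; simp only [Set.mem_Icc] at this; omega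
  have hstep : ∀ σ v, (if step x σ v = l then (1 : ℝ) else 0) = ξ v (σ v) := by
    intro σ v
    have h1 := hcases v
    have h2 := hcases (σ v)
    simp only [hξ, step, update]
    split_ifs <;> first | omega | rfl
  have hE : ∀ v, ∫ σ, ξ v (σ v) ∂stepLaw s n = p v := by
    intro v
    rw [integral_choice s (by omega) v (ξ v)]
    have : ∑ w, ξ v w = A := rfl
    rw [this]
    simp only [hξ, hp]
    rcases hcases v with h | h <;> simp [h, hmdef]
  have hp01 : ∀ v, 0 ≤ p v ∧ p v ≤ 1 := by
    intro v
    rcases hcases v with h | h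
    · simp only [hp, h, if_true, one_mul]
      rw [if_neg (by omega), zero_mul, add_zero]
      exact ⟨div_nonneg (by linarith) hm.le, (div_le_one hm).2 (by linarith)⟩
    · have hB1 : 1 ≤ B := one_le_count h
      simp only [hp, h, if_true, one_mul]
      rw [if_neg (by omega), zero_mul, zero_add]
      exact ⟨div_nonneg (by linarith) hm.le, (div_le_one hm).2 (by linarith)⟩
  have hpsum : ∑ v, p v = A := by
    simp only [hp]
    rw [Finset.sum_add_distrib, ← Finset.sum_mul, ← Finset.sum_mul]
    change A * _ + B * _ = A
    field_simp
    rw [hmdef]; linear_combination hAB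
  have hp2 : ∑ v, (p v - p v ^ 2) = A * B * (n - 2 * deficit s) / m ^ 2 := by
    have : ∀ v, p v - p v ^ 2
        = (if x v = l then 1 else 0) * ((A - deficit s) / m - ((A - deficit s) / m) ^ 2)
          + (if x v = l + 1 then 1 else 0) * (A / m - (A / m) ^ 2) := by
      intro v
      rcases hcases v with h | h <;> simp [hp, h]
    simp_rw [this]
    rw [Finset.sum_add_distrib, ← Finset.sum_mul, ← Finset.sum_mul]
    change A * _ + B * _ = _
    have hBm : B = m + deficit s - A := by rw [hmdef]; linarith
    have hnm : (n : ℝ) = m + deficit s := by rw [hmdef]; ring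
    rw [hBm, hnm]
    field_simp
    ring
  set X : Fin n → Fin n → ℝ := fun v w => ξ v w - p v with hX
  have hXE : ∀ v, ∫ σ, X v (σ v) ∂stepLaw s n = 0 := by
    intro v
    simp only [hX]
    rw [integral_sub (I _) (I _), hE]; simp
  have hξsq : ∀ v w, ξ v w ^ 2 = ξ v w := by
    intro v w; simp only [hξ]; split_ifs <;> simp
  have hX2 : ∀ v, ∫ σ, X v (σ v) ^ 2 ∂stepLaw s n = p v - p v ^ 2 := by
    intro v
    have : ∀ σ : Fin n → Fin n, X v (σ v) ^ 2 = (1 - 2 * p v) * ξ v (σ v) + p v ^ 2 := by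
      intro σ
      simp only [hX]
      linear_combination hξsq v (σ v)
    simp_rw [this]
    rw [integral_add (I _) (I _), integral_const_mul, hE]
    simp; ring
  have hX3 : ∀ v, ∫ σ, X v (σ v) ^ 3 ∂stepLaw s n ≤ p v - p v ^ 2 := by
    intro v
    rw [← hX2]
    refine integral_mono (I _) (I _) fun σ => ?_
    have h1 : X v (σ v) ≤ 1 := by
      have := (hp01 v).1
      simp only [hX, hξ]; split_ifs <;> linarith
    have := mul_le_mul_of_nonneg_left h1 (sq_nonneg (X v (σ v)))
    simp only
    linarith [pow_succ (X v (σ v)) 2]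
  obtain ⟨m1, m2, m3⟩ := moments_sum s X hXE Finset.univ
  have hsum : ∀ σ, ∑ v, X v (σ v) = count (step x σ) l - A := by
    intro σ
    simp only [hX]
    rw [Finset.sum_sub_distrib, hpsum, count]
    simp_rw [hstep]
  simp_rw [hsum] at m1 m2 m3
  simp_rw [hX2] at m2
  rw [hp2] at m2
  -- Without self-sampling this amounts to (n - 1)² ≤ 2n(n - 2), which needs n ≥ 3.
  have hW : A * B / (2 * n) ≤ A * B * (n - 2 * deficit s) / m ^ 2 := by
    rw [div_le_div_iff₀ (by positivity) (by positivity), mul_assoc (A * B)]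
    refine mul_le_mul_of_nonneg_left ?_ (mul_nonneg (by linarith : (0 : ℝ) ≤ A) hB)
    rw [hmdef]
    nlinarith
  have := integral_sqrt_le s (W := A * B / (2 * n)) (U := fun σ => count (step x σ) l) (fun σ => count_nonneg _ _) hl m1
    (by rw [m2]; exact hW) (by
      rw [m2, m3, ← hp2]
      exact Finset.sum_le_sum fun v _ => hX3 v)
  refine this.trans (le_of_eq ?_)
  have hA0 : A ≠ 0 := by linarith
  have : √A ≠ 0 := by positivity
  field_simp
  ring

theorem nextMean_sqrt_count_top_le (s : Sampling) (hn : 3 ≤ n) {x : Fin n → ℤ} {l : ℤ}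
    (hx : ∀ v, x v ∈ Set.Icc l (l + 1)) (hl : 1 ≤ count x (l + 1)) :
    nextMean s (fun y => √(count y (l + 1))) x
      ≤ √(count x (l + 1)) - count x l / (32 * n * √(count x (l + 1))) := by
  have := nextMean_sqrt_count_bottom_le s hn (x := -x) (l := -(l + 1)) (fun v => by
    have := hx v
    simp only [Set.mem_Icc, Pi.neg_apply] at *
    omega) (by rwa [count_neg, neg_neg])
  rw [nextMean_neg] at this
  simp only [count_neg, neg_neg, show -(-(l + 1) + 1) = l by ring] at this
  exact this

/-- A potential that controls the time with exactly two opinions. -/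
noncomputable def twoPotential (x : Fin n → ℤ) : ℝ :=
  if lo x + 2 ≤ hi x then 64 * n
  else if hi x = lo x + 1 then 32 * √n * (√(count x (lo x)) + √(count x (hi x))) else 0

theorem twoPotential_nonneg (x : Fin n → ℤ) : 0 ≤ twoPotential x := by
  rw [twoPotential]; positivity

theorem twoPotential_le (x : Fin n → ℤ) : twoPotential x ≤ 64 * n := by
  rw [twoPotential]
  split_ifs
  · rfl
  · have h1 := Real.sqrt_le_sqrt (count_le x (lo x))
    have h2 := Real.sqrt_le_sqrt (count_le x (hi x))
    have h3 := Real.mul_self_sqrt (Nat.cast_nonneg (α := ℝ) n)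
    have h4 := Real.sqrt_nonneg (n : ℝ)
    nlinarith
  · positivity

/-- Bounding the roots in the denominators by √n, the two losses add up to at least (A + B)/(32 n√n)
= 1/(32√n). The value 64n for larger spreads is an upper bound for the potential. -/
theorem nextMean_twoPotential_le (s : Sampling) (hn : 3 ≤ n) (x : Fin n → ℤ) :
    nextMean s twoPotential x ≤ twoPotential x - if hi x = lo x + 1 then 1 else 0 := by
  have hn0 : 0 < n := by omega
  by_cases h2 : lo x + 2 ≤ hi x
  · rw [if_neg (by omega), sub_zero]
    refine (nextMean_le_nextMean s (g := fun _ => 64 * (n : ℝ)) fun σ => twoPotential_le _).trans ?_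
    rw [nextMean_const, twoPotential, if_pos h2]
  · by_cases h1 : hi x = lo x + 1
    · have hx : ∀ v, x v ∈ Set.Icc (lo x) (lo x + 1) := h1 ▸ mem_Icc_lo_hi x
      have hA := one_le_count_lo hn0 x
      have hB := one_le_count_hi hn0 x
      have hAB := count_add_two hx
      rw [h1] at hB
      have ha := nextMean_sqrt_count_bottom_le s hn hx hA
      have hb := nextMean_sqrt_count_top_le s hn hx hB
      have hAn := Real.sqrt_le_sqrt (count_le x (lo x))
      have hBn := Real.sqrt_le_sqrt (count_le x (lo x + 1))
      rw [if_pos h1, twoPotential, if_neg h2, if_pos h1, h1]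
      refine (nextMean_le_nextMean s (g := fun y => 32 * √n *
        (√(count y (lo x)) + √(count y (lo x + 1)))) fun σ => ?_).trans ?_
      · have h3 := lo_le_lo_step hn0 x σ
        have h4 := hi_step_le_hi hn0 x σ
        rw [twoPotential, if_neg (by omega)]
        split_ifs with h5
        · rw [show lo (step x σ) = lo x by omega, show hi (step x σ) = lo x + 1 by omega]
        · positivity
      · rw [nextMean_const_mul, nextMean_add]
        set A := count x (lo x)
        set B := count x (lo x + 1)
        have hnR : (0 : ℝ) < n := by exact_mod_cast hn0
        have hsn : 0 < √(n : ℝ) := Real.sqrt_pos.2 hnR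
        have hsA : 0 < √A := Real.sqrt_pos.2 (by linarith)
        have hsB : 0 < √B := Real.sqrt_pos.2 (by linarith)
        have k1 : B / (32 * n * √n) ≤ B / (32 * n * √A) := by gcongr
        have k2 : A / (32 * n * √n) ≤ A / (32 * n * √B) := by gcongr
        have k3 : 32 * √(n : ℝ) * (B / (32 * n * √n) + A / (32 * n * √n)) = 1 := by
          rw [← add_div, add_comm B A, hAB]; field_simp
        have := mul_le_mul_of_nonneg_left (add_le_add ha hb) (by positivity : 0 ≤ 32 * √(n : ℝ))
        nlinarith [mul_le_mul_of_nonneg_left (add_le_add k1 k2)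
          (by positivity : 0 ≤ 32 * √(n : ℝ))]
    · rw [if_neg h1, sub_zero, twoPotential, if_neg h2, if_neg h1]
      refine (nextMean_le_nextMean s (g := fun _ => 0) fun σ => ?_).trans ?_
      · have h3 := lo_le_lo_step hn0 x σ
        have h4 := hi_step_le_hi hn0 x σ
        rw [twoPotential, if_neg (by omega), if_neg (by omega)]
      · rw [nextMean_const]

end TwoOpinions

/-! ### Expected consensus time and convergence to a winner -/

section Consensus

variable {n : ℕ}

theorem mean_indicator (s : Sampling) (t : ℕ) (p : (Fin n → ℤ) → Prop) [DecidablePred p]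
    (x : Fin n → ℤ) :
    mean s t (fun y => if p y then (1 : ℝ) else 0) x
      = (completeLaw s n).real {ω | p (opinions x ω t)} := by
  have hm : MeasurableSet {ω : ℕ → Fin n → Fin n | p (opinions x ω t)} :=
    measurable_opinions x t (MeasurableSet.of_discrete (s := {y | p y}))
  rw [← integral_indicator_one hm, mean]
  refine integral_congr_ae (ae_of_all _ fun ω => ?_)
  simp [Set.indicator_apply]

/-- The first T terms are at most 1 each, and the later ones are dominated by a geometric series
with sum 2. -/
theorem sum_mean_spread_le (s : Sampling) (hn : 2 ≤ n) {k T : ℕ} {x : Fin n → ℤ}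
    (hk : hi x - lo x + 1 ≤ k) (hT : n * (4 * (n : ℝ) ^ 2) ^ k ≤ 2 ^ T) (N : ℕ) :
    ∑ t ∈ Finset.range N, mean s t (fun y => if lo y + 3 ≤ hi y then (1 : ℝ) else 0) x
      ≤ T + 2 := by
  set f : ℕ → ℝ := fun t => mean s t (fun y => if lo y + 3 ≤ hi y then (1 : ℝ) else 0) x with hf
  have hnR : (2 : ℝ) ≤ n := by exact_mod_cast hn
  have h0 : ∀ t, 0 ≤ f t := fun t => mean_nonneg s (fun y => by positivity) t x
  have h1 : ∀ t, f t ≤ 1 := fun t => by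
    refine (mean_mono s (g := fun _ => 1) (fun y => ?_) t x).trans (mean_const s t 1 x).le
    split_ifs <;> norm_num
  have h2 : ∀ j, f (T + j) ≤ 1 / 2 ^ j := fun j => by
    refine (mean_indicator_spread_le s hn k x hk (T + j)).trans ?_
    rw [pow_add, ← div_div]
    gcongr
    rw [div_le_one (by positivity)]
    have : 0 ≤ (4 * (n : ℝ) ^ 2) ^ k := by positivity
    nlinarith
  have h3 : ∀ j, ∑ t ∈ Finset.range (T + j), f t ≤ T + 2 - 2 / 2 ^ j := by
    intro j
    induction j with
    | zero => simpa using Finset.sum_le_sum fun t (_ : t ∈ Finset.range T) => h1 t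
    | succ j ih =>
      rw [← add_assoc, Finset.sum_range_succ]
      have := h2 j
      have e : (2 : ℝ) / 2 ^ (j + 1) = 2 / 2 ^ j - 1 / 2 ^ j := by rw [pow_succ]; field_simp; ring
      linarith
  calc ∑ t ∈ Finset.range N, f t ≤ ∑ t ∈ Finset.range (T + N), f t :=
        Finset.sum_le_sum_of_subset_of_nonneg (Finset.range_mono (by omega)) fun t _ _ => h0 t
    _ ≤ T + 2 - 2 / 2 ^ N := h3 N
    _ ≤ T + 2 := by
        have : (0 : ℝ) ≤ 2 / 2 ^ N := by positivity
        linarith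

/-- The indicator of the states without consensus. -/
noncomputable def disagreement (x : Fin n → ℤ) : ℝ := if hi x = lo x then 0 else 1

theorem disagreement_nonneg (x : Fin n → ℤ) : 0 ≤ disagreement x := by
  rw [disagreement]; positivity

theorem sum_mean_disagreement_le (s : Sampling) (hn : 3 ≤ n) {k T : ℕ} {x : Fin n → ℤ}
    (hk : hi x - lo x + 1 ≤ k) (hT : n * (4 * (n : ℝ) ^ 2) ^ k ≤ 2 ^ T) (N : ℕ) :
    ∑ t ∈ Finset.range N, mean s t disagreement x ≤ 66 * n + T + 2 := by
  have h1 := sum_mean_spread_le s (by omega) hk hT N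
  have h2 := (sum_mean_le_of_drift s (threePotential_nonneg s (by omega))
    (nextMean_threePotential_le s (by omega : 2 ≤ n)) N x).trans (threePotential_le s (by omega) x)
  have h3 := (sum_mean_le_of_drift s twoPotential_nonneg
    (nextMean_twoPotential_le s hn) N x).trans (twoPotential_le x)
  have h4 : ∀ t, mean s t disagreement x
      ≤ mean s t (fun y => if lo y + 3 ≤ hi y then (1 : ℝ) else 0) x
        + (mean s t (fun y => if hi y = lo y + 2 then 1 else 0) x
        + mean s t (fun y => if hi y = lo y + 1 then 1 else 0) x) := by
    intro t
    rw [← mean_add, ← mean_add]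
    refine mean_mono s (fun y => ?_) t x
    have := lo_le_hi (by omega) y
    rw [disagreement]
    split_ifs <;> first | omega | norm_num
  have h5 := Finset.sum_le_sum fun t (_ : t ∈ Finset.range N) => h4 t
  rw [Finset.sum_add_distrib, Finset.sum_add_distrib] at h5
  linarith

theorem disagreement_eq_one {x : Fin n → ℤ} (h : ¬∃ i : ℤ, ∀ v, x v = i) :
    disagreement x = 1 := by
  refine if_neg fun he => h ⟨lo x, fun v => le_antisymm ?_ (lo_le x v)⟩
  exact (le_hi x v).trans he.le

/-- Every time before consensus contributes 1 to the series, which is infinite if consensus never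
occurs. -/
theorem consensusTime_le (x : Fin n → ℤ) (ω : ℕ → Fin n → Fin n) :
    consensusTime x ω ≤ ∑' t, ENNReal.ofReal (disagreement (opinions x ω t)) := by
  classical
  by_cases h : ∃ t, ∃ i : ℤ, ∀ v, opinions x ω t v = i
  · have h1 : consensusTime x ω ≤ (Nat.find h : ℝ≥0∞) :=
      iInf₂_le (Nat.find h) (Nat.find_spec h)
    refine h1.trans (le_trans ?_ (ENNReal.sum_le_tsum (Finset.range (Nat.find h))))
    rw [Finset.sum_congr rfl fun t ht => by
      rw [disagreement_eq_one (Nat.find_min h (Finset.mem_range.1 ht))]]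
    simp
  · push Not at h
    have : ∀ t, ENNReal.ofReal (disagreement (opinions x ω t)) = 1 := fun t => by
      rw [disagreement_eq_one (by push Not; exact h t), ENNReal.ofReal_one]
    simp [this]

theorem lintegral_consensusTime_le (s : Sampling) (hn : 3 ≤ n) {k T : ℕ} {x : Fin n → ℤ}
    (hk : hi x - lo x + 1 ≤ k) (hT : n * (4 * (n : ℝ) ^ 2) ^ k ≤ 2 ^ T) :
    ∫⁻ ω, consensusTime x ω ∂completeLaw s n ≤ ENNReal.ofReal (66 * n + T + 2) := by
  calc ∫⁻ ω, consensusTime x ω ∂completeLaw s n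
      ≤ ∫⁻ ω, ∑' t, ENNReal.ofReal (disagreement (opinions x ω t)) ∂completeLaw s n :=
        lintegral_mono fun ω => consensusTime_le x ω
    _ = ∑' t, ∫⁻ ω, ENNReal.ofReal (disagreement (opinions x ω t)) ∂completeLaw s n := by
        refine lintegral_tsum fun t => ?_
        exact ((Measurable.of_discrete
          (f := fun y : Fin n → ℤ => ENNReal.ofReal (disagreement y))).comp
          (measurable_opinions x t)).aemeasurable
    _ = ∑' t, ENNReal.ofReal (mean s t disagreement x) := by
        congr 1
        ext t
        rw [mean, ofReal_integral_eq_lintegral_ofReal (integrable_opinions s t _ x)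
          (ae_of_all _ fun ω => disagreement_nonneg _)]
    _ ≤ ENNReal.ofReal (66 * n + T + 2) := by
        refine ENNReal.tsum_le_of_sum_range_le fun N => ?_
        rw [← ENNReal.ofReal_sum_of_nonneg fun t _ => mean_nonneg s disagreement_nonneg t x]
        exact ENNReal.ofReal_le_ofReal (sum_mean_disagreement_le s hn hk hT N)

theorem tendsto_mean_disagreement (s : Sampling) (hn : 3 ≤ n) {k T : ℕ} {x : Fin n → ℤ}
    (hk : hi x - lo x + 1 ≤ k) (hT : n * (4 * (n : ℝ) ^ 2) ^ k ≤ 2 ^ T) :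
    Tendsto (fun t => mean s t disagreement x) atTop (𝓝 0) :=
  (summable_of_sum_range_le (fun t => mean_nonneg s disagreement_nonneg t x)
    (sum_mean_disagreement_le s hn hk hT)).tendsto_atTop_zero

/-- Consensus is absorbing, so the events of consensus on i at time t increase to the event that i
wins. -/
theorem tendsto_winProb (s : Sampling) (x : Fin n → ℤ) (i : ℤ) :
    Tendsto (fun t => mean s t (fun y => if ∀ v, y v = i then (1 : ℝ) else 0) x) atTop
      (𝓝 (winProb s x i)) := by
  simp_rw [mean_indicator s _ (fun y : Fin n → ℤ => ∀ v, y v = i)]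
  have hmono : Monotone fun t => {ω : ℕ → Fin n → Fin n | ∀ v, opinions x ω t v = i} := by
    refine monotone_nat_of_le_succ fun t ω hω v => ?_
    rw [opinions_succ, step, hω v, hω, update_self]
  have hU : wins x i = ⋃ t, {ω : ℕ → Fin n → Fin n | ∀ v, opinions x ω t v = i} := by
    ext ω; simp [wins]
  rw [winProb, hU]
  exact (ENNReal.tendsto_toReal (measure_ne_top _ _)).comp (tendsto_measure_iUnion_atTop hmono)

end Consensus

/-! ### The law of the winning opinion -/

section Winner

variable {n : ℕ}

/-- The average amount by which the opinions are below `i`. -/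
noncomputable def below (i : ℤ) (x : Fin n → ℤ) : ℝ := (∑ v, max ((i : ℝ) - x v) 0) / n

/-- The average amount by which the opinions are above `i`. -/
noncomputable def above (i : ℤ) (x : Fin n → ℤ) : ℝ := (∑ v, max ((x v : ℝ) - i) 0) / n

theorem average_eq (x : Fin n → ℤ) : average x = (∑ v, (x v : ℝ)) / n := by simp [average]

theorem average_neg (x : Fin n → ℤ) : average (-x) = -average x := by
  simp [average_eq, neg_div]

theorem mean_above (s : Sampling) (t : ℕ) (i : ℤ) (x : Fin n → ℤ) :
    mean s t (above i) x = mean s t (below (-i)) (-x) := by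
  rw [mean_neg]
  congr 1
  ext y
  rw [above, below]
  congr 1
  refine Finset.sum_congr rfl fun v _ => ?_
  congr 1
  push_cast [Pi.neg_apply]
  ring

theorem below_nonneg (i : ℤ) (x : Fin n → ℤ) : 0 ≤ below i x :=
  div_nonneg (Finset.sum_nonneg fun _ _ => le_max_right _ _) (Nat.cast_nonneg n)

theorem above_nonneg (i : ℤ) (x : Fin n → ℤ) : 0 ≤ above i x :=
  div_nonneg (Finset.sum_nonneg fun _ _ => le_max_right _ _) (Nat.cast_nonneg n)

theorem nextMean_below_le (s : Sampling) (hn : 2 ≤ n) (i : ℤ) (x : Fin n → ℤ) :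
    nextMean s (below i) x ≤ below i x := by
  have h := nextMean_sum_le_of_convex s hn (fun a => max ((i : ℝ) - a) 0) (fun a b hab => by
    have hab' : (a : ℝ) + 1 ≤ b := by exact_mod_cast hab
    push_cast
    rcases max_cases ((i : ℝ) - (a + 1)) 0 with h1 | h1 <;>
    rcases max_cases ((i : ℝ) - (b - 1)) 0 with h2 | h2 <;>
    rw [h1.1, h2.1] <;>
    linarith [le_max_left ((i : ℝ) - a) 0, le_max_left ((i : ℝ) - b) 0,
      le_max_right ((i : ℝ) - a) 0, le_max_right ((i : ℝ) - b) 0]) x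
  have e : nextMean s (below i) x
      = (nextMean s (fun y => ∑ v, max ((i : ℝ) - y v) 0) x) / n := integral_div _ _
  rw [e, below]
  gcongr

/-- Unless i is the middle opinion, all opinions lie on one side of i and the first term suffices.
For the middle opinion `below i` is A/n while i minus the average is (A - B)/n, and the missing
min(A, B) is at most √(AB). -/
theorem below_le_of_window (hn : 0 < n) (i : ℤ) {l : ℤ} {x : Fin n → ℤ}
    (hx : ∀ v, x v ∈ Set.Icc l (l + 2)) :
    below i x ≤ max (i - average x) 0 + outerMean l x / n := by
  have hnR : (0 : ℝ) < n := by exact_mod_cast hn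
  have hY : 0 ≤ outerMean l x / n := div_nonneg (outerMean_nonneg _ _) hnR.le
  have havg : (i : ℝ) - average x = (∑ v, ((i : ℝ) - x v)) / n := by
    rw [average_eq, Finset.sum_sub_distrib]
    simp
    field_simp
  rcases lt_trichotomy i (l + 1) with h | h | h
  · have : below i x = 0 := by
      rw [below, Finset.sum_eq_zero, zero_div]
      intro v _
      have h1 : i ≤ x v := by have := (hx v).1; omega
      have h2 : (i : ℝ) ≤ x v := by exact_mod_cast h1
      exact max_eq_right (by linarith)
    rw [this]
    exact add_nonneg (le_max_right _ _) hY
  · have h1 : below i x = count x l / n := by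
      rw [below, count]
      congr 1
      refine Finset.sum_congr rfl fun v _ => ?_
      have h2 := hx v
      simp only [Set.mem_Icc] at h2
      obtain h3 | h3 | h3 : x v = l ∨ x v = l + 1 ∨ x v = l + 2 := by omega
      all_goals simp [h, h3]
    have h4 : (i : ℝ) - average x = (count x l - count x (l + 2)) / n := by
      rw [havg, count, count, ← Finset.sum_sub_distrib]
      congr 1
      refine Finset.sum_congr rfl fun v _ => ?_
      have h2 := hx v
      simp only [Set.mem_Icc] at h2
      obtain h3 | h3 | h3 : x v = l ∨ x v = l + 1 ∨ x v = l + 2 := by omega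
      all_goals simp [h, h3]
      norm_num
    rw [h1]
    have hA := count_nonneg x l
    have hB := count_nonneg x (l + 2)
    have hsq := outerMean_sq l x
    have hY0 := outerMean_nonneg l x
    rcases le_total (count x l) (count x (l + 2)) with h5 | h5
    · have : count x l ≤ outerMean l x := by nlinarith
      have := div_le_div_of_nonneg_right this hnR.le
      linarith [le_max_right ((i : ℝ) - average x) 0]
    · have : count x (l + 2) ≤ outerMean l x := by nlinarith
      have := div_le_div_of_nonneg_right this hnR.le
      have := le_max_left ((i : ℝ) - average x) 0
      rw [h4, sub_div] at this
      rw [h4, sub_div]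
      linarith
  · have : below i x = i - average x := by
      rw [havg, below]
      congr 1
      refine Finset.sum_congr rfl fun v _ => ?_
      have h1 : x v ≤ i := by have := (hx v).2; omega
      have h2 : (x v : ℝ) ≤ i := by exact_mod_cast h1
      exact max_eq_left (by linarith)
    rw [this]
    linarith [le_max_left ((i : ℝ) - average x) 0]

theorem mean_average (s : Sampling) (hn : 2 ≤ n) (t : ℕ) (x : Fin n → ℤ) :
    mean s t average x = average x := by
  rw [average_eq, ← mean_sum_opinions s hn t x, ← mean_div]
  simp_rw [← average_eq]

theorem mean_max_sub_average_le (s : Sampling) (hn : 2 ≤ n) (t : ℕ) (i : ℤ) (x : Fin n → ℤ) :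
    mean s t (fun y => max (i - average y) 0) x ≤ max (i - average x) 0 + √(t / n) := by
  have hnR : (0 : ℝ) < n := by exact_mod_cast (by omega : 0 < n)
  have h1 : mean s t (fun y => |average y - average x|) x ≤ √(t / n) := by
    refine Real.le_sqrt_of_sq_le ((mean_sq_le s t _ x).trans ?_)
    have : (fun y : Fin n → ℤ => |average y - average x| ^ 2)
        = fun y => (∑ v, (y v : ℝ) - ∑ v, (x v : ℝ)) ^ 2 / n ^ 2 := by
      ext y
      rw [sq_abs, average_eq, average_eq, ← sub_div, div_pow]
    rw [this, mean_div, div_le_div_iff₀ (by positivity) hnR]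
    have := mean_sq_sum_le s hn t x
    nlinarith
  have h2 : ∀ y : Fin n → ℤ, max (i - average y) 0
      ≤ max (i - average x) 0 + |average y - average x| := by
    intro y
    have h3 := neg_abs_le (average y - average x)
    have h4 := abs_nonneg (average y - average x)
    refine max_le ?_ (add_nonneg (le_max_right _ _) h4)
    linarith [le_max_left ((i : ℝ) - average x) 0]
  refine (mean_mono s h2 t x).trans ?_
  rw [mean_add, mean_const]
  linarith

theorem mean_below_le_of_window (s : Sampling) (hn : 2 ≤ n) (i : ℤ) {l : ℤ} {x : Fin n → ℤ}
    (hx : ∀ v, x v ∈ Set.Icc l (l + 2)) (t : ℕ) :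
    mean s t (below i) x ≤ max (i - average x) 0 + √(t / n) + 1 / (t + 1) := by
  have hnR : (0 : ℝ) < n := by exact_mod_cast (by omega : 0 < n)
  refine (mean_mono_on s (D := {y : Fin n → ℤ | ∀ v, y v ∈ Set.Icc l (l + 2)})
    (fun y hy σ => step_mem_Icc hy σ)
    (fun y hy => below_le_of_window (by omega) i hy) t hx).trans ?_
  rw [mean_add, mean_div]
  have h1 := mean_max_sub_average_le s hn t i x
  have h2 : mean s t (outerMean l) x / n ≤ 1 / (t + 1) := by
    rw [div_le_iff₀ hnR]
    refine (mean_outerMean_le s hn hx t).trans ?_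
    rw [div_mul_eq_mul_div, one_mul]
    gcongr
    linarith [deficit_nonneg s]
  have e : mean s t (fun y => outerMean l y) x = mean s t (outerMean l) x := rfl
  linarith

/-- The expected amount by which the opinions are below an integer that is not much above the
initial average. -/
theorem mean_below_le (s : Sampling) (hn : 2 ≤ n) {k T K : ℕ} {a b : ℤ} {x : Fin n → ℤ}
    (hx : ∀ v, x v ∈ Set.Icc a b) (hk : hi x - lo x + 1 ≤ k)
    (hT : n * (4 * (n : ℝ) ^ 2) ^ k ≤ 2 ^ T) {i : ℤ} (hi' : i ≤ a + K) {t : ℕ} (ht : T + T ≤ t) :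
    mean s t (below i) x
      ≤ max (i - average x) 0 + (2 * √(T / n) + 1 / (T + 1) + K / n) := by
  have hnR : (0 : ℝ) < n := by exact_mod_cast (by omega : 0 < n)
  -- The supermartingale property reduces to time 2T: T steps to reach three opinions and T more to
  -- thin out an outer one. The former fails with probability at most 1/n, where only the bound K on
  -- `below i` is used; hence the term K/n.
  refine (mean_antitone_of_le s (nextMean_below_le s hn i) x ht).trans ?_
  simp only
  rw [mean_add_time]
  have hpt : ∀ y ∈ {y : Fin n → ℤ | ∀ v, y v ∈ Set.Icc a b}, mean s T (below i) y
      ≤ max (i - average y) 0 + ((√(T / n) + 1 / (T + 1))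
        + K * (if lo y + 3 ≤ hi y then 1 else 0)) := by
    intro y hy
    split_ifs with h
    · have h1 := mean_antitone_of_le s (nextMean_below_le s hn i) y (Nat.zero_le T)
      simp only [mean_zero] at h1
      have h2 : below i y ≤ K := by
        rw [below, div_le_iff₀ hnR]
        calc ∑ v, max ((i : ℝ) - y v) 0 ≤ ∑ _v : Fin n, (K : ℝ) := by
              refine Finset.sum_le_sum fun v _ => max_le ?_ (Nat.cast_nonneg K)
              have h3 : i ≤ y v + K := by have := (hy v).1; omega
              have h4 : (i : ℝ) ≤ y v + K := by exact_mod_cast h3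
              linarith
          _ = K * n := by simp [mul_comm]
      have h5 : 0 ≤ √((T : ℝ) / n) + 1 / (T + 1) := by positivity
      linarith [le_max_right ((i : ℝ) - average y) 0]
    · have h1 : ∀ v, y v ∈ Set.Icc (lo y) (lo y + 2) := fun v =>
        ⟨lo_le y v, (le_hi y v).trans (by omega)⟩
      have := mean_below_le_of_window s hn i h1 T
      linarith
  refine (mean_mono_on s (D := {y : Fin n → ℤ | ∀ v, y v ∈ Set.Icc a b})
    (fun y hy σ => step_mem_Icc hy σ) hpt T hx).trans ?_
  rw [mean_add, mean_add, mean_const, mean_const_mul]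
  have h1 := mean_max_sub_average_le s hn T i x
  have h2 : mean s T (fun y => if lo y + 3 ≤ hi y then (1 : ℝ) else 0) x ≤ 1 / n := by
    refine (mean_indicator_spread_le s hn k x hk T).trans ?_
    rw [div_le_div_iff₀ (by positivity) hnR]
    linarith
  have h3 := mul_le_mul_of_nonneg_left h2 (Nat.cast_nonneg (α := ℝ) K)
  rw [mul_one_div] at h3
  linarith

theorem hi_neg_sub_lo_neg_le (hn : 0 < n) (x : Fin n → ℤ) : hi (-x) - lo (-x) ≤ hi x - lo x := by
  have h1 : hi (-x) ≤ -lo x := hi_le_of_forall hn fun v => neg_le_neg (lo_le x v)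
  have h2 : -hi x ≤ lo (-x) := le_lo_of_forall hn fun v => neg_le_neg (le_hi x v)
  omega

theorem mean_above_le (s : Sampling) (hn : 2 ≤ n) {k T K : ℕ} {a b : ℤ} {x : Fin n → ℤ}
    (hx : ∀ v, x v ∈ Set.Icc a b) (hk : hi x - lo x + 1 ≤ k)
    (hT : n * (4 * (n : ℝ) ^ 2) ^ k ≤ 2 ^ T) {i : ℤ} (hi' : b ≤ i + K) {t : ℕ} (ht : T + T ≤ t) :
    mean s t (above i) x
      ≤ max (average x - i) 0 + (2 * √(T / n) + 1 / (T + 1) + K / n) := by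
  rw [mean_above]
  have := mean_below_le s hn (x := -x) (a := -b) (b := -a) (i := -i) (K := K) (fun v => by
    have := hx v
    simp only [Set.mem_Icc, Pi.neg_apply] at *
    omega) (by have := hi_neg_sub_lo_neg_le (by omega) x; omega) hT (by omega) ht
  rw [average_neg] at this
  push_cast at this
  rwa [show -(i : ℝ) - -average x = average x - i by ring] at this

/-- The average of `x v - i` truncated to the interval `[0, 1]`. -/
noncomputable def clipped (i : ℤ) (x : Fin n → ℤ) : ℝ :=
  average x - i + below i x - above (i + 1) x

theorem clipped_eq (hn : 0 < n) (i : ℤ) (x : Fin n → ℤ) :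
    clipped i x = (∑ v, (((x v : ℝ) - i) + max ((i : ℝ) - x v) 0 - max ((x v : ℝ) - (i + 1)) 0)) / n
      := by
  have hnR : (0 : ℝ) < n := by exact_mod_cast hn
  rw [clipped, average_eq, below, above, Finset.sum_sub_distrib, Finset.sum_add_distrib,
    Finset.sum_sub_distrib]
  simp
  field_simp

theorem clipped_mem (hn : 0 < n) (i : ℤ) (x : Fin n → ℤ) : clipped i x ∈ Set.Icc (0 : ℝ) 1 := by
  have hnR : (0 : ℝ) < n := by exact_mod_cast hn
  have h : ∀ z w : ℝ, 0 ≤ (z - w) + max (w - z) 0 - max (z - (w + 1)) 0 ∧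
      (z - w) + max (w - z) 0 - max (z - (w + 1)) 0 ≤ 1 := by
    intro z w
    rcases max_cases (w - z) 0 with h1 | h1 <;>
    rcases max_cases (z - (w + 1)) 0 with h2 | h2 <;>
    rw [h1.1, h2.1] <;> constructor <;> linarith
  rw [clipped_eq hn]
  refine ⟨div_nonneg (Finset.sum_nonneg fun v _ => (h _ _).1) hnR.le, ?_⟩
  rw [div_le_one hnR, ← sum_vertices_one]
  exact Finset.sum_le_sum fun v _ => (h _ _).2

theorem below_const (hn : 0 < n) (i j : ℤ) {x : Fin n → ℤ} (h : ∀ v, x v = j) :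
    below i x = max ((i : ℝ) - j) 0 := by
  have hnR : (0 : ℝ) < n := by exact_mod_cast hn
  simp [below, h]
  field_simp

theorem above_const (hn : 0 < n) (i j : ℤ) {x : Fin n → ℤ} (h : ∀ v, x v = j) :
    above i x = max ((j : ℝ) - i) 0 := by
  have hnR : (0 : ℝ) < n := by exact_mod_cast hn
  simp [above, h]
  field_simp

theorem average_const (hn : 0 < n) (j : ℤ) {x : Fin n → ℤ} (h : ∀ v, x v = j) :
    average x = j := by
  have hnR : (0 : ℝ) < n := by exact_mod_cast hn
  simp [average_eq, h]
  field_simp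

theorem clipped_const (hn : 0 < n) (i j : ℤ) {x : Fin n → ℤ} (h : ∀ v, x v = j) :
    clipped i x = j - i + max ((i : ℝ) - j) 0 - max ((j : ℝ) - (i + 1)) 0 := by
  rw [clipped, average_const hn j h, below_const hn i j h, above_const hn (i + 1) j h]
  push_cast; rfl

theorem disagreement_or_const (x : Fin n → ℤ) :
    disagreement x = 1 ∨ ∃ j : ℤ, ∀ v, x v = j := by
  by_cases h : ∃ j : ℤ, ∀ v, x v = j
  · exact Or.inr h
  · exact Or.inl (disagreement_eq_one h)

theorem indicator_succ_le_clipped (hn : 0 < n) (i : ℤ) (x : Fin n → ℤ) :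
    (if ∀ v, x v = i + 1 then (1 : ℝ) else 0) ≤ clipped i x := by
  split_ifs with h
  · rw [clipped_const hn i (i + 1) h]
    push_cast
    norm_num
  · exact (clipped_mem hn i x).1

theorem indicator_le_one_sub_clipped (hn : 0 < n) (i : ℤ) (x : Fin n → ℤ) :
    (if ∀ v, x v = i then (1 : ℝ) else 0) ≤ 1 - clipped i x := by
  split_ifs with h
  · rw [clipped_const hn i i h]
    norm_num
  · linarith [(clipped_mem hn i x).2]

/-- At consensus on j, `clipped i` is 0 for j ≤ i and 1 for j ≥ i + 1. A consensus beyond i + 1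
makes `above (i + 1)` at least 1, and without consensus `disagreement` is 1. -/
theorem clipped_le (hn : 0 < n) (i : ℤ) (x : Fin n → ℤ) :
    clipped i x ≤ (if ∀ v, x v = i + 1 then (1 : ℝ) else 0) + disagreement x + above (i + 1) x := by
  have h0 : (0 : ℝ) ≤ if ∀ v, x v = i + 1 then (1 : ℝ) else 0 := by positivity
  have h1 := disagreement_nonneg x
  have h2 := above_nonneg (i + 1) x
  have h3 := (clipped_mem hn i x).2
  rcases disagreement_or_const x with h | ⟨j, h⟩
  · linarith
  · rcases lt_trichotomy j (i + 1) with hj | hj | hj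
    · have h4 : (j : ℝ) ≤ i := by exact_mod_cast (by omega : j ≤ i)
      have : clipped i x = 0 := by
        rw [clipped_const hn i j h, max_eq_left (by linarith), max_eq_right (by linarith)]
        ring
      linarith
    · rw [if_pos (hj ▸ h)]
      linarith
    · have h4 : (i : ℝ) + 1 + 1 ≤ j := by exact_mod_cast (by omega : i + 1 + 1 ≤ j)
      have : 1 ≤ above (i + 1) x := by
        rw [above_const hn _ j h]
        push_cast
        exact le_max_of_le_left (by linarith)
      linarith

theorem one_sub_clipped_le (hn : 0 < n) (i : ℤ) (x : Fin n → ℤ) :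
    1 - clipped i x ≤ (if ∀ v, x v = i then (1 : ℝ) else 0) + disagreement x + below i x := by
  have h0 : (0 : ℝ) ≤ if ∀ v, x v = i then (1 : ℝ) else 0 := by positivity
  have h1 := disagreement_nonneg x
  have h2 := below_nonneg i x
  have h3 := (clipped_mem hn i x).1
  rcases disagreement_or_const x with h | ⟨j, h⟩
  · linarith
  · rcases lt_trichotomy j i with hj | hj | hj
    · have h4 : (j : ℝ) + 1 ≤ i := by exact_mod_cast hj
      have : 1 ≤ below i x := by
        rw [below_const hn _ j h]
        exact le_max_of_le_left (by linarith)
      linarith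
    · rw [if_pos (hj ▸ h)]
      linarith
    · have h4 : (i : ℝ) + 1 ≤ j := by exact_mod_cast hj
      have : clipped i x = 1 := by
        rw [clipped_const hn i j h, max_eq_right (by linarith), max_eq_left (by linarith)]
        ring
      linarith

theorem one_le_indicator_add (hn : 0 < n) (i : ℤ) (x : Fin n → ℤ) :
    1 ≤ (if ∀ v, x v = i then (1 : ℝ) else 0) + disagreement x + (below i x + above i x) := by
  have h0 : (0 : ℝ) ≤ if ∀ v, x v = i then (1 : ℝ) else 0 := by positivity
  have h1 := disagreement_nonneg x
  have h2 := below_nonneg i x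
  have h3 := above_nonneg i x
  rcases disagreement_or_const x with h | ⟨j, h⟩
  · linarith
  · rcases lt_trichotomy j i with hj | hj | hj
    · have h4 : (j : ℝ) + 1 ≤ i := by exact_mod_cast hj
      have : 1 ≤ below i x := by
        rw [below_const hn _ j h]
        exact le_max_of_le_left (by linarith)
      linarith
    · rw [if_pos (hj ▸ h)]
      linarith
    · have h4 : (i : ℝ) + 1 ≤ j := by exact_mod_cast hj
      have : 1 ≤ above i x := by
        rw [above_const hn _ j h]
        exact le_max_of_le_left (by linarith)
      linarith

theorem mean_clipped (s : Sampling) (hn : 2 ≤ n) (t : ℕ) (i : ℤ) (x : Fin n → ℤ) :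
    mean s t (clipped i) x
      = average x - i + mean s t (below i) x - mean s t (above (i + 1)) x := by
  have : mean s t (clipped i) x
      = mean s t (fun y => average y - i + below i y - above (i + 1) y) x := rfl
  rw [this, mean_sub, mean_add, mean_sub, mean_const]
  have e : mean s t (fun y => average y) x = average x := mean_average s hn t x
  rw [e]

variable {s : Sampling} {x : Fin n → ℤ} {i : ℤ} {η : ℝ}

/-- The mean of `clipped i` is the initial average minus i up to the means of `below i` and `above
(i + 1)`. It is compared with the indicator of consensus on i + 1 from both sides, and then the time
tends to infinity. -/
theorem abs_winProb_succ_sub_le (hn : 2 ≤ n)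
    (hd : Tendsto (fun t => mean s t disagreement x) atTop (𝓝 0))
    (hb : ∀ᶠ t in atTop, mean s t (below i) x ≤ η)
    (ha : ∀ᶠ t in atTop, mean s t (above (i + 1)) x ≤ η) :
    |winProb s x (i + 1) - (average x - i)| ≤ 2 * η := by
  have hw := tendsto_winProb s x (i + 1)
  have hn0 : 0 < n := by omega
  have hη : 0 ≤ η := by
    obtain ⟨t, ht⟩ := hb.exists
    exact (mean_nonneg s (below_nonneg i) t x).trans ht
  rw [abs_le]
  constructor
  · have : ∀ᶠ t in atTop, average x - i - 2 * η
        ≤ mean s t (fun y => if ∀ v, y v = i + 1 then (1 : ℝ) else 0) x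
          + mean s t disagreement x := by
      filter_upwards [hb, ha] with t hbt hat
      have h1 := mean_mono s (clipped_le hn0 i) t x
      rw [mean_add, mean_add, mean_clipped s hn] at h1
      have := mean_nonneg s (below_nonneg i) t x
      have e1 : mean s t (fun y => disagreement y) x = mean s t disagreement x := rfl
      have e2 : mean s t (fun y => above (i + 1) y) x = mean s t (above (i + 1)) x := rfl
      linarith
    have := ge_of_tendsto (hw.add hd) this
    linarith
  · have : ∀ᶠ t in atTop, mean s t (fun y => if ∀ v, y v = i + 1 then (1 : ℝ) else 0) x
        ≤ average x - i + η := by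
      filter_upwards [hb] with t hbt
      have h1 := mean_mono s (indicator_succ_le_clipped hn0 i) t x
      rw [mean_clipped s hn] at h1
      have := mean_nonneg s (above_nonneg (i + 1)) t x
      linarith
    have := le_of_tendsto hw this
    linarith

theorem abs_winProb_sub_le (hn : 2 ≤ n)
    (hd : Tendsto (fun t => mean s t disagreement x) atTop (𝓝 0))
    (hb : ∀ᶠ t in atTop, mean s t (below i) x ≤ η)
    (ha : ∀ᶠ t in atTop, mean s t (above (i + 1)) x ≤ η) :
    |winProb s x i - (i + 1 - average x)| ≤ 2 * η := by
  have hw := tendsto_winProb s x i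
  have hn0 : 0 < n := by omega
  have hη : 0 ≤ η := by
    obtain ⟨t, ht⟩ := hb.exists
    exact (mean_nonneg s (below_nonneg i) t x).trans ht
  have e : ∀ t, mean s t (fun y => 1 - clipped i y) x = 1 - mean s t (clipped i) x := fun t => by
    rw [mean_sub, mean_const]
  rw [abs_le]
  constructor
  · have : ∀ᶠ t in atTop, i + 1 - average x - 2 * η
        ≤ mean s t (fun y => if ∀ v, y v = i then (1 : ℝ) else 0) x
          + mean s t disagreement x := by
      filter_upwards [hb, ha] with t hbt hat
      have h1 := mean_mono s (one_sub_clipped_le hn0 i) t x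
      rw [mean_add, mean_add, e, mean_clipped s hn] at h1
      have := mean_nonneg s (above_nonneg (i + 1)) t x
      have e1 : mean s t (fun y => disagreement y) x = mean s t disagreement x := rfl
      have e2 : mean s t (fun y => below i y) x = mean s t (below i) x := rfl
      linarith
    have := ge_of_tendsto (hw.add hd) this
    linarith
  · have : ∀ᶠ t in atTop, mean s t (fun y => if ∀ v, y v = i then (1 : ℝ) else 0) x
        ≤ i + 1 - average x + η := by
      filter_upwards [ha] with t hat
      have h1 := mean_mono s (indicator_le_one_sub_clipped hn0 i) t x
      rw [e, mean_clipped s hn] at h1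
      have := mean_nonneg s (below_nonneg i) t x
      linarith
    have := le_of_tendsto hw this
    linarith

theorem one_sub_le_winProb {η' : ℝ} (hn : 2 ≤ n)
    (hd : Tendsto (fun t => mean s t disagreement x) atTop (𝓝 0))
    (hb : ∀ᶠ t in atTop, mean s t (below i) x ≤ η)
    (ha : ∀ᶠ t in atTop, mean s t (above i) x ≤ η') :
    1 - (η + η') ≤ winProb s x i := by
  have hw := tendsto_winProb s x i
  have hn0 : 0 < n := by omega
  have : ∀ᶠ t in atTop, 1 - (η + η')
      ≤ mean s t (fun y => if ∀ v, y v = i then (1 : ℝ) else 0) x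
        + mean s t disagreement x := by
    filter_upwards [hb, ha] with t hbt hat
    have h1 := mean_mono s (one_le_indicator_add hn0 i) t x
    rw [mean_add, mean_add, mean_add, mean_const] at h1
    have e1 : mean s t (fun y => disagreement y) x = mean s t disagreement x := rfl
    have e2 : mean s t (fun y => below i y) x = mean s t (below i) x := rfl
    have e3 : mean s t (fun y => above i y) x = mean s t (above i) x := rfl
    linarith
  have := ge_of_tendsto (hw.add hd) this
  linarith

end Winner

/-! ### Choice of the time scale and vanishing of the errors -/

section Asymptotics

/-- A time by which, with high probability, at most three consecutive opinions are left. -/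
noncomputable def reductionTime (k n : ℕ) : ℕ := ⌈8 * (k : ℝ) * Real.log n⌉₊

/-- As 4 ≤ n² and k ≥ 1, the left side is at most n^(5k), and 8 log 2 > 5. -/
theorem mul_pow_le_two_pow_reductionTime {k n : ℕ} (hk : 1 ≤ k) (hn : 2 ≤ n) :
    n * (4 * (n : ℝ) ^ 2) ^ k ≤ 2 ^ reductionTime k n := by
  have hnR : (2 : ℝ) ≤ n := by exact_mod_cast hn
  have h1 : n * (4 * (n : ℝ) ^ 2) ^ k ≤ (n : ℝ) ^ (5 * k) := by
    calc n * (4 * (n : ℝ) ^ 2) ^ k ≤ (n : ℝ) ^ k * ((n : ℝ) ^ 4) ^ k := by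
          gcongr
          · exact le_self_pow₀ (by linarith) (by omega)
          · have h4 : (4 : ℝ) ≤ (n : ℝ) ^ 2 := by nlinarith
            nlinarith
      _ = (n : ℝ) ^ (5 * k) := by rw [← pow_mul, ← pow_add]; congr 1; ring
  refine h1.trans ?_
  rw [← Real.log_le_log_iff (by positivity) (by positivity), Real.log_pow, Real.log_pow]
  have h2 : 8 * (k : ℝ) * Real.log n ≤ reductionTime k n := Nat.le_ceil _
  have h3 := Real.log_two_gt_d9
  have h4 : 0 ≤ (k : ℝ) * Real.log n :=
    mul_nonneg k.cast_nonneg (Real.log_nonneg (by linarith))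
  push_cast
  nlinarith

variable {k : ℕ → ℕ}

theorem tendsto_log_natCast : Tendsto (fun n : ℕ => Real.log n) atTop atTop :=
  Real.tendsto_log_atTop.comp tendsto_natCast_atTop_atTop

theorem tendsto_mul_log_div
    (hk : (fun n : ℕ => (k n : ℝ)) =o[atTop] fun n : ℕ => (n : ℝ) / (Real.log n) ^ 2) :
    Tendsto (fun n : ℕ => k n * Real.log n / n) atTop (𝓝 0) := by
  have h := hk.tendsto_div_nhds_zero.mul tendsto_log_natCast.inv_tendsto_atTop
  rw [zero_mul] at h
  refine h.congr' ?_
  filter_upwards [tendsto_log_natCast.eventually_gt_atTop 0, eventually_gt_atTop 0] with n h1 h2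
  have h3 : (n : ℝ) ≠ 0 := by positivity
  simp only [Pi.inv_apply]
  field_simp

theorem tendsto_natCast_div
    (hk : (fun n : ℕ => (k n : ℝ)) =o[atTop] fun n : ℕ => (n : ℝ) / (Real.log n) ^ 2) :
    Tendsto (fun n : ℕ => (k n : ℝ) / n) atTop (𝓝 0) := by
  have h := (tendsto_mul_log_div hk).mul tendsto_log_natCast.inv_tendsto_atTop
  rw [zero_mul] at h
  refine h.congr' ?_
  filter_upwards [tendsto_log_natCast.eventually_gt_atTop 0] with n h1
  simp only [Pi.inv_apply]
  field_simp

theorem tendsto_reductionTime_div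
    (hk : (fun n : ℕ => (k n : ℝ)) =o[atTop] fun n : ℕ => (n : ℝ) / (Real.log n) ^ 2) :
    Tendsto (fun n : ℕ => (reductionTime (k n) n : ℝ) / n) atTop (𝓝 0) := by
  have h := ((tendsto_mul_log_div hk).const_mul 8).add (tendsto_one_div_atTop_nhds_zero_nat (𝕜 := ℝ))
  rw [mul_zero, zero_add] at h
  refine squeeze_zero (fun n => by positivity) (fun n => ?_) h
  have h1 : (reductionTime (k n) n : ℝ) ≤ 8 * (k n : ℝ) * Real.log n + 1 :=
    (Nat.ceil_lt_add_one (mul_nonneg (by positivity) (Real.log_natCast_nonneg n))).le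
  calc (reductionTime (k n) n : ℝ) / n ≤ (8 * (k n : ℝ) * Real.log n + 1) / n := by gcongr
    _ = 8 * (k n * Real.log n / n) + 1 / n := by ring

/-- The error term for the distribution of the winning opinion. -/
noncomputable def winError (k n : ℕ) : ℝ :=
  2 * √((reductionTime k n : ℝ) / n) + 1 / ((reductionTime k n : ℝ) + 1) + (k : ℝ) / n

/-- The reduction time is o(n), so the average hardly moves; it also tends to infinity, so one outer
opinion becomes negligible. -/
theorem tendsto_winError
    (hk : (fun n : ℕ => (k n : ℝ)) =o[atTop] fun n : ℕ => (n : ℝ) / (Real.log n) ^ 2)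
    (hk1 : ∀ᶠ n in atTop, 1 ≤ k n) : Tendsto (fun n => winError (k n) n) atTop (𝓝 0) := by
  have h1 := ((Real.continuous_sqrt.tendsto 0).comp (tendsto_reductionTime_div hk)).const_mul 2
  have h2 : Tendsto (fun n => 1 / ((reductionTime (k n) n : ℝ) + 1)) atTop (𝓝 0) := by
    refine squeeze_zero' (Eventually.of_forall fun n => by positivity) ?_
      tendsto_log_natCast.inv_tendsto_atTop
    filter_upwards [hk1, tendsto_log_natCast.eventually_gt_atTop 0] with n hkn hlog
    have h3 : 8 * (k n : ℝ) * Real.log n ≤ reductionTime (k n) n := Nat.le_ceil _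
    have h4 : (1 : ℝ) ≤ k n := by exact_mod_cast hkn
    rw [Pi.inv_apply, ← one_div]
    gcongr
    nlinarith
  have := (h1.add h2).add (tendsto_natCast_div hk)
  simpa [winError] using this

theorem isEquivalent_of_tendsto_sub {u v : ℕ → ℝ} (h : Tendsto (fun n => u n - v n) atTop (𝓝 0))
    {δ : ℝ} (hδ : 0 < δ) (hv : ∀ᶠ n in atTop, δ ≤ v n) : u ~[atTop] v := by
  have h1 : (fun n => u n - v n) =o[atTop] fun _ => (1 : ℝ) := (isLittleO_one_iff ℝ).2 h
  have h2 : (fun _ => (1 : ℝ)) =O[atTop] v := by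
    refine IsBigO.of_bound (1 / δ) ?_
    filter_upwards [hv] with n hn
    rw [Real.norm_of_nonneg (hδ.le.trans hn), norm_one, div_mul_eq_mul_div, one_mul,
      one_le_div hδ]
    exact hn
  exact h1.trans_isBigO h2

theorem average_mem_Icc {n : ℕ} (hn : 0 < n) {a b : ℤ} {x : Fin n → ℤ}
    (hx : ∀ v, x v ∈ Set.Icc a b) : average x ∈ Set.Icc (a : ℝ) b := by
  have hnR : (0 : ℝ) < n := by exact_mod_cast hn
  rw [average_eq, Set.mem_Icc, le_div_iff₀ hnR, div_le_iff₀ hnR]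
  have h1 : ∑ _v : Fin n, (a : ℝ) ≤ ∑ v, (x v : ℝ) :=
    Finset.sum_le_sum fun v _ => by exact_mod_cast (hx v).1
  have h2 : ∑ v, (x v : ℝ) ≤ ∑ _v : Fin n, (b : ℝ) :=
    Finset.sum_le_sum fun v _ => by exact_mod_cast (hx v).2
  simp only [Finset.sum_const, Finset.card_univ, Fintype.card_fin, nsmul_eq_mul] at h1 h2
  constructor <;> linarith

/-! ### Bounds for a fixed number of vertices -/

section Fixed

variable {n k : ℕ} {x : Fin n → ℤ}

theorem one_le_of_mem_Icc (hn : 0 < n) (hx : ∀ v, x v ∈ Set.Icc (1 : ℤ) k) : 1 ≤ k := by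
  have := hx ⟨0, hn⟩
  simp only [Set.mem_Icc] at this
  omega

theorem spread_le_of_mem_Icc (hn : 0 < n) (hx : ∀ v, x v ∈ Set.Icc (1 : ℤ) k) :
    hi x - lo x + 1 ≤ k := by
  have h1 := le_lo_of_forall hn fun v => (hx v).1
  have h2 := hi_le_of_forall hn fun v => (hx v).2
  omega

theorem tendsto_mean_disagreement_of_mem_Icc (s : Sampling) (hn : 3 ≤ n)
    (hx : ∀ v, x v ∈ Set.Icc (1 : ℤ) k) :
    Tendsto (fun t => mean s t disagreement x) atTop (𝓝 0) :=
  tendsto_mean_disagreement s hn (spread_le_of_mem_Icc (by omega) hx)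
    (mul_pow_le_two_pow_reductionTime (one_le_of_mem_Icc (by omega) hx) (by omega))

theorem eventually_mean_below_le (s : Sampling) (hn : 2 ≤ n) (hx : ∀ v, x v ∈ Set.Icc (1 : ℤ) k)
    {i : ℤ} (hi' : (i : ℝ) ≤ average x + 1) :
    ∀ᶠ t in atTop, mean s t (below i) x ≤ max (i - average x) 0 + winError k n := by
  filter_upwards [eventually_ge_atTop (reductionTime k n + reductionTime k n)] with t ht
  have h1 := (average_mem_Icc (by omega) hx).2
  -- The average is at most k, so i exceeds the lowest possible opinion 1 by at most k; this allows
  -- K = k in `mean_below_le`.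
  have h2 : i ≤ 1 + k := by
    have : (i : ℝ) ≤ 1 + k := by push_cast at h1; linarith
    exact_mod_cast this
  exact mean_below_le s hn hx (spread_le_of_mem_Icc (by omega) hx)
    (mul_pow_le_two_pow_reductionTime (one_le_of_mem_Icc (by omega) hx) hn) h2 ht

theorem eventually_mean_above_le (s : Sampling) (hn : 2 ≤ n) (hx : ∀ v, x v ∈ Set.Icc (1 : ℤ) k)
    {i : ℤ} (hi' : average x ≤ i + 1) :
    ∀ᶠ t in atTop, mean s t (above i) x ≤ max (average x - i) 0 + winError k n := by
  filter_upwards [eventually_ge_atTop (reductionTime k n + reductionTime k n)] with t ht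
  have h1 := (average_mem_Icc (by omega) hx).1
  have h2 : (k : ℤ) ≤ i + k := by
    have : (1 : ℝ) ≤ i + 1 := by push_cast at h1; linarith
    have : (1 : ℤ) ≤ i + 1 := by exact_mod_cast this
    omega
  exact mean_above_le s hn hx (spread_le_of_mem_Icc (by omega) hx)
    (mul_pow_le_two_pow_reductionTime (one_le_of_mem_Icc (by omega) hx) hn) h2 ht

theorem abs_winProb_sub_le_winError (s : Sampling) (hn : 3 ≤ n)
    (hx : ∀ v, x v ∈ Set.Icc (1 : ℤ) k) {i : ℤ} (h1 : (i : ℝ) < average x)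
    (h2 : average x < i + 1) :
    |winProb s x i - (i + 1 - average x)| ≤ 2 * winError k n ∧
    |winProb s x (i + 1) - (average x - i)| ≤ 2 * winError k n := by
  have hb := eventually_mean_below_le s (by omega) hx (i := i) (by linarith)
  have ha := eventually_mean_above_le s (by omega) hx (i := i + 1) (by push_cast; linarith)
  have hd := tendsto_mean_disagreement_of_mem_Icc s hn hx
  rw [max_eq_right (by linarith), zero_add] at hb
  rw [max_eq_right (by push_cast; linarith), zero_add] at ha
  exact ⟨abs_winProb_sub_le (by omega) hd hb ha, abs_winProb_succ_sub_le (by omega) hd hb ha⟩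

theorem one_sub_le_winProb_of_near (s : Sampling) (hn : 3 ≤ n)
    (hx : ∀ v, x v ∈ Set.Icc (1 : ℤ) k) {i : ℤ} (h : |average x - i| ≤ 1) :
    1 - (2 * |average x - i| + 2 * winError k n) ≤ winProb s x i := by
  have h' := abs_le.1 h
  have hb := eventually_mean_below_le s (by omega) hx (i := i) (by linarith)
  have ha := eventually_mean_above_le s (by omega) hx (i := i) (by linarith)
  have hd := tendsto_mean_disagreement_of_mem_Icc s hn hx
  have := one_sub_le_winProb (by omega) hd hb ha
  have h1 : max ((i : ℝ) - average x) 0 ≤ |average x - i| :=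
    max_le (by linarith [neg_abs_le (average x - i)]) (abs_nonneg _)
  have h2 : max (average x - i) 0 ≤ |average x - i| := max_le (le_abs_self _) (abs_nonneg _)
  linarith

theorem one_sub_le_threeLeftBy (s : Sampling) (hn : 2 ≤ n) (hx : ∀ v, x v ∈ Set.Icc (1 : ℤ) k)
    {T : ℝ} (hT : reductionTime k n ≤ T) :
    1 - 1 / n ≤ (completeLaw s n).real (threeLeftBy x T) := by
  have hnR : (0 : ℝ) < n := by exact_mod_cast (by omega : 0 < n)
  set t := reductionTime k n with ht
  have hsub : {ω : ℕ → Fin n → Fin n | ¬ lo (opinions x ω t) + 3 ≤ hi (opinions x ω t)}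
      ⊆ threeLeftBy x T := by
    intro ω hω
    refine ⟨t, hT, lo (opinions x ω t), fun v => ⟨lo_le _ v, (le_hi _ v).trans ?_⟩⟩
    have hω' : ¬ lo (opinions x ω t) + 3 ≤ hi (opinions x ω t) := hω
    omega
  refine le_trans ?_ (measureReal_mono hsub)
  rw [← mean_indicator s t (fun y : Fin n → ℤ => ¬ lo y + 3 ≤ hi y)]
  have h1 : mean s t (fun y => if lo y + 3 ≤ hi y then (1 : ℝ) else 0) x ≤ 1 / n := by
    refine (mean_indicator_spread_le s hn k x (spread_le_of_mem_Icc (by omega) hx) t).trans ?_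
    rw [div_le_div_iff₀ (by positivity) hnR]
    have := mul_pow_le_two_pow_reductionTime (one_le_of_mem_Icc (by omega) hx) hn
    linarith
  have h2 : mean s t (fun y => if ¬ lo y + 3 ≤ hi y then (1 : ℝ) else 0) x
      = mean s t (fun y => 1 - if lo y + 3 ≤ hi y then (1 : ℝ) else 0) x := by
    congr 1
    ext y
    split_ifs <;> norm_num
  rw [h2, mean_sub, mean_const]
  linarith

end Fixed

end Asymptotics

end IncrementalVoting

/-! ### The main theorem -/

open IncrementalVoting in
theorem theorem1 :
    ∃ C : ℝ, 0 < C ∧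
      ∀ (s : Sampling) (k : ℕ → ℕ) (x₀ : (n : ℕ) → Fin n → ℤ),
        ((fun n : ℕ => (k n : ℝ)) =o[atTop] fun n : ℕ => (n : ℝ) / (Real.log n) ^ 2) →
        (∀ (n : ℕ) (v : Fin n), x₀ n v ∈ Set.Icc (1 : ℤ) (k n)) →
        -- the winning opinion, when the average lies strictly between two integers
        (∀ i : ℕ → ℤ,
          (∀ᶠ n in atTop, (i n : ℝ) < average (x₀ n) ∧ average (x₀ n) < i n + 1) →
          Tendsto (fun n => winProb s (x₀ n) (i n) - (i n + 1 - average (x₀ n))) atTop (𝓝 0) ∧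
          Tendsto (fun n => winProb s (x₀ n) (i n + 1) - (average (x₀ n) - i n)) atTop (𝓝 0) ∧
          ((∃ δ : ℝ, 0 < δ ∧ ∀ᶠ n in atTop, δ ≤ i n + 1 - average (x₀ n)) →
            (fun n => winProb s (x₀ n) (i n)) ~[atTop] fun n => i n + 1 - average (x₀ n)) ∧
          ((∃ δ : ℝ, 0 < δ ∧ ∀ᶠ n in atTop, δ ≤ average (x₀ n) - i n) →
            (fun n => winProb s (x₀ n) (i n + 1)) ~[atTop] fun n => average (x₀ n) - i n)) ∧
        -- the winning opinion, when the average is asymptotically an integer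
        (∀ i : ℕ → ℤ,
          Tendsto (fun n => average (x₀ n) - i n) atTop (𝓝 0) →
          Tendsto (fun n => winProb s (x₀ n) (i n)) atTop (𝓝 1)) ∧
        -- at most three consecutive opinions are left after `C k log n` steps, w.h.p.
        Tendsto
          (fun n : ℕ => (completeLaw s n).real (threeLeftBy (x₀ n) (C * k n * Real.log n)))
          atTop (𝓝 1) ∧
        -- the expected time to consensus
        ∀ᶠ n : ℕ in atTop,
          ∫⁻ ω, consensusTime (x₀ n) ω ∂(completeLaw s n) ≤ ENNReal.ofReal (C * n) := by
  -- Any C with 8k log n + 1 ≤ C k log n and 66n + T + 2 ≤ Cn for large n works; here the reduction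
  -- time T is eventually at most n.
  refine ⟨100, by norm_num, fun s k x₀ hk hx => ?_⟩
  have hk1 : ∀ᶠ n in atTop, 1 ≤ k n := by
    filter_upwards [eventually_gt_atTop 0] with n hn using one_le_of_mem_Icc hn (hx n)
  have herr := (tendsto_winError hk hk1).const_mul 2
  rw [mul_zero] at herr
  refine ⟨fun i hi => ?_, fun i hi => ?_, ?_, ?_⟩
  · have hmain : ∀ᶠ n in atTop,
        |winProb s (x₀ n) (i n) - (i n + 1 - average (x₀ n))| ≤ 2 * winError (k n) n ∧
        |winProb s (x₀ n) (i n + 1) - (average (x₀ n) - i n)| ≤ 2 * winError (k n) n := by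
      filter_upwards [hi, eventually_ge_atTop 3] with n h hn
      exact abs_winProb_sub_le_winError s hn (hx n) h.1 h.2
    have h1 : Tendsto (fun n => winProb s (x₀ n) (i n) - (i n + 1 - average (x₀ n))) atTop
        (𝓝 0) := squeeze_zero_norm' (hmain.mono fun n h => h.1) herr
    have h2 : Tendsto (fun n => winProb s (x₀ n) (i n + 1) - (average (x₀ n) - i n)) atTop
        (𝓝 0) := squeeze_zero_norm' (hmain.mono fun n h => h.2) herr
    exact ⟨h1, h2, fun ⟨δ, hδ, h⟩ => isEquivalent_of_tendsto_sub h1 hδ h,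
      fun ⟨δ, hδ, h⟩ => isEquivalent_of_tendsto_sub h2 hδ h⟩
  · have habs : Tendsto (fun n => |average (x₀ n) - i n|) atTop (𝓝 0) := by simpa using hi.abs
    have hlow := ((habs.const_mul 2).add herr).const_sub 1
    rw [mul_zero, add_zero, sub_zero] at hlow
    refine tendsto_of_tendsto_of_tendsto_of_le_of_le' hlow tendsto_const_nhds ?_
      (Eventually.of_forall fun n => measureReal_le_one)
    filter_upwards [habs.eventually (ge_mem_nhds one_pos), eventually_ge_atTop 3] with n h hn
    exact one_sub_le_winProb_of_near s hn (hx n) h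
  · have hlow := (tendsto_one_div_atTop_nhds_zero_nat (𝕜 := ℝ)).const_sub 1
    rw [sub_zero] at hlow
    refine tendsto_of_tendsto_of_tendsto_of_le_of_le' hlow tendsto_const_nhds ?_
      (Eventually.of_forall fun n => measureReal_le_one)
    filter_upwards [hk1, eventually_ge_atTop 2, tendsto_log_natCast.eventually_ge_atTop 1]
      with n hkn hn hlog
    refine one_sub_le_threeLeftBy s hn (hx n) ?_
    have h1 : (reductionTime (k n) n : ℝ) ≤ 8 * (k n : ℝ) * Real.log n + 1 :=
      (Nat.ceil_lt_add_one (mul_nonneg (by positivity) (Real.log_natCast_nonneg n))).le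
    have h2 : (1 : ℝ) ≤ k n := by exact_mod_cast hkn
    nlinarith
  · filter_upwards [(tendsto_reductionTime_div hk).eventually (ge_mem_nhds one_pos),
      eventually_ge_atTop 3] with n hT hn
    have hnR : (3 : ℝ) ≤ n := by exact_mod_cast hn
    rw [div_le_one (by linarith)] at hT
    refine (lintegral_consensusTime_le s hn (spread_le_of_mem_Icc (by omega) (hx n))
      (mul_pow_le_two_pow_reductionTime (one_le_of_mem_Icc (by omega) (hx n)) (by omega))).trans ?_
    exact ENNReal.ofReal_le_ofReal (by linarith)
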